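/- Notation. Let $\mathbb C_+=\{z\in\mathbb C:\operatorname{Re}z>0\}$, $\Sigma_\theta=\{z\ne0:|\arg z|<\theta\}$ for $\theta\in(0,\pi]$ and $\Sigma_0=(0,\infty)$. A closed, densely defined operator $A$ on a complex Banach space $X$ is *sectorial of angle* $\theta\in[0,\pi)$ if $\sigma(A)\subset\overline{\Sigma}_\theta$ and $M_\psi(A):=\sup_{z\in\Sigma_{\pi-\psi}}\|z(z+A)^{-1}\|<\infty$ for each $\psi\in(\theta,\pi)$; $A\in\mathrm{Sect}(\pi/2-)$ means that $A$ is sectorial of some angle $\theta\in[0,\pi/2)$, and then $M_A:=M_{\pi/2}(A)=\sup_{z\in\mathbb C_+}\|z(z+A)^{-1}\|$. The operator $A$ satisfies the (GSF) assumptions if $\sigma(A)\subset\overline{\mathbb C}_+$ and $\sup_{\alpha>0}\alpha\int_{\mathbb R}|\langle(\alpha+i\beta+A)^{-2}x,x^*\rangle|\,d\beta<\infty$ for all $x\in X$, $x^*\in X^*$; $\gamma_A$ denotes the minimal constant such that $$\int_{\mathbb R}|\langle(\alpha+i\beta+A)^{-2}x,x^*\rangle|\,d\beta\le\frac{\gamma_A}{\alpha}\|x\|\,\|x^*\|\qquad(\alpha>0,\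 x\in X,\ x^*\in X^*).$$ Let $\mathcal B$ be the algebra of all holomorphic $f:\mathbb C_+\to\mathbb C$ with $\|f\|_{\mathcal B_0}:=\int_0^\infty\sup_{\beta\in\mathbb R}|f'(\alpha+i\beta)|\,d\alpha<\infty$. Such $f$ are bounded and $f(\infty):=\lim_{\operatorname{Re}z\to\infty}f(z)$ exists; put $\|f\|_{\mathcal B}:=\|f\|_\infty+\|f\|_{\mathcal B_0}$. A *$\mathcal B$-calculus* for $A$ is an algebra homomorphism $\Phi:\mathcal B\to L(X)$, bounded with respect to $\|\cdot\|_{\mathcal B}$, such that $\Phi$ maps $\lambda\mapsto(\lambda+z)^{-1}$ to $(z+A)^{-1}$ for each $z\in\mathbb C_+$. Theorem. There is an absolute constant $C>0$ such that the following holds for every complex Banach space $X$ and every closed densely defined operator $A\in\mathrm{Sect}(\pi/2-)$ on $X$. The operator $A$ satisfies the (GSF) assumptions and $$\gamma_A\le C M_A(\log M_A+1).$$ Hence $A$ has a $\mathcal B$-calculus $f\mapsto f(A)$, where $f(A)\in L(X)$ is the operator determined by $$\langle f(A)x,x^*\rangle=f(\infty)\langle x,x^*\rangle-\frac2\pi\int_0^\infty\alpha\int_{\mathbb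 R}\langle(\alpha-i\beta+A)^{-2}x,x^*\rangle f'(\alpha+i\beta)\,d\beta\,d\alpha\qquad(x\in X,\ x^*\in X^*),$$ with an absolutely convergent integral. For all $f\in\mathcal B$, $$\|f(A)\|\le C M_A(\log M_A+1)\|f\|_{\mathcal B}$$ and $$f(A)=f(\infty)-\frac2\pi\int_0^\infty\alpha\int_{\mathbb R}(\alpha-i\beta+A)^{-2}f'(\alpha+i\beta)\,d\beta\,d\alpha,$$ where the integral converges absolutely in operator norm. (For $X=\{0\}$, where $M_A=0$, read $0\cdot\log 0=0$.) -/

import Mathlib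

open MeasureTheory Filter Topology Set
open scoped ENNReal

namespace BesovCalculus

/-! ## The algebra of analytic Besov functions on the right half-plane -/

/-- The open right half-plane. -/
def halfPlane : Set ℂ := {z | 0 < z.re}

/-- Extension by zero of a function on the open right half-plane; it only serves to speak of
complex derivatives at points of the (open) half-plane. -/
noncomputable def extend (f : halfPlane → ℂ) : ℂ → ℂ :=
  open Classical in fun z => if h : z ∈ halfPlane then f ⟨z, h⟩ else 0

/-- The complex derivative of a function on the right half-plane, at the point `α + iβ`
(meaningful for `0 < α`). -/
noncomputable def derivAt (f : halfPlane → ℂ) (α β : ℝ) : ℂ :=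
  deriv (extend f) (α + β * Complex.I)

/-- The seminorm `∫₀^∞ sup_β |f'(α + iβ)| dα`, possibly infinite. -/
noncomputable def besovSeminorm (f : halfPlane → ℂ) : ℝ≥0∞ :=
  ∫⁻ α in Ioi (0 : ℝ), ⨆ β : ℝ, ‖derivAt f α β‖ₑ

/-- `f` is holomorphic on the right half-plane and its Besov seminorm is finite. -/
def IsBesov (f : halfPlane → ℂ) : Prop :=
  DifferentiableOn ℂ (extend f) halfPlane ∧ besovSeminorm f < ⊤

/-- The filter of neighbourhoods of infinity in the sense `Re z → ∞`. -/
def reAtTop : Filter halfPlane := comap (fun z => (z : ℂ).re) atTop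

/-- `f(∞) = lim_{Re z → ∞} f(z)`. -/
noncomputable def valueAtInfty (f : halfPlane → ℂ) : ℂ :=
  limUnder reAtTop f

/-- The norm `‖f‖_∞ + ∫₀^∞ sup_β |f'(α + iβ)| dα`. -/
noncomputable def besovNorm (f : halfPlane → ℂ) : ℝ :=
  (⨆ z : halfPlane, ‖f z‖ₑ).toReal + (besovSeminorm f).toReal

theorem isOpen_halfPlane : IsOpen halfPlane :=
  isOpen_lt continuous_const Complex.continuous_re

theorem mem_halfPlane {α : ℝ} (hα : 0 < α) (β : ℝ) : (α + β * Complex.I : ℂ) ∈ halfPlane := by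
  simpa [halfPlane] using hα

theorem extend_eqOn (f : halfPlane → ℂ) (G : ℂ → ℂ) (h : ∀ z : halfPlane, f z = G z) :
    EqOn (extend f) G halfPlane := fun z hz => by
  simp only [extend, dif_pos hz]; exact h ⟨z, hz⟩

theorem extend_coe (f : halfPlane → ℂ) (z : halfPlane) : extend f z = f z := by
  simp [extend]

theorem derivAt_eq (f : halfPlane → ℂ) (G : ℂ → ℂ) (h : ∀ z : halfPlane, f z = G z)
    {α : ℝ} (hα : 0 < α) (β : ℝ) : derivAt f α β = deriv G (α + β * Complex.I) :=
  Filter.EventuallyEq.deriv_eq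
    ((extend_eqOn f G h).eventuallyEq_of_mem (isOpen_halfPlane.mem_nhds (mem_halfPlane hα β)))

theorem continuousOn_deriv {f : halfPlane → ℂ} (hf : DifferentiableOn ℂ (extend f) halfPlane) :
    ContinuousOn (deriv (extend f)) halfPlane :=
  (hf.deriv isOpen_halfPlane).continuousOn

theorem aemeasurable_sup {f : halfPlane → ℂ} (hf : DifferentiableOn ℂ (extend f) halfPlane) :
    AEMeasurable (fun α : ℝ => ⨆ β : ℝ, ‖derivAt f α β‖ₑ) (volume.restrict (Ioi 0)) := by
  refine ⟨fun α => ⨆ q : ℚ, ‖derivAt f α q‖ₑ, ?_, ?_⟩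
  · refine Measurable.iSup fun q => ?_
    unfold derivAt
    exact ((measurable_deriv (extend f)).comp (by fun_prop)).enorm
  · filter_upwards [ae_restrict_mem measurableSet_Ioi] with α hα
    have hc : Continuous fun β : ℝ => ‖derivAt f α β‖ₑ := by
      refine continuous_enorm.comp ?_
      exact (continuousOn_deriv hf).comp_continuous (by fun_prop) (fun β => mem_halfPlane hα β)
    refine le_antisymm (iSup_le fun β => ?_) (iSup_le fun q => le_iSup (fun β : ℝ => ‖derivAt f α β‖ₑ) q)
    refine Rat.denseRange_cast.induction_on (p := fun β : ℝ => ‖derivAt f α β‖ₑ ≤ _) β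
      (isClosed_le hc continuous_const) fun q => ?_
    exact le_iSup (fun q : ℚ => ‖derivAt f α q‖ₑ) q

/-- Increments along horizontal lines are controlled by the tail of the seminorm. -/
theorem enorm_sub_le {f : halfPlane → ℂ} (hf : DifferentiableOn ℂ (extend f) halfPlane)
    {a b : ℝ} (ha : 0 < a) (hab : a ≤ b) (β : ℝ) :
    ‖extend f (b + β * Complex.I) - extend f (a + β * Complex.I)‖ₑ ≤
      ∫⁻ α in Ioi a, ⨆ β : ℝ, ‖derivAt f α β‖ₑ := by
  have hd : ∀ t ∈ uIcc a b,
      HasDerivAt (fun t : ℝ => extend f (t + β * Complex.I)) (derivAt f t β) t := by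
    intro t ht
    rw [uIcc_of_le hab] at ht
    have hm := mem_halfPlane (lt_of_lt_of_le ha ht.1) β
    have h1 := ((hf _ hm).differentiableAt (isOpen_halfPlane.mem_nhds hm)).hasDerivAt
    have h2 : HasDerivAt (fun t : ℝ => (t + β * Complex.I : ℂ)) 1 t :=
      (Complex.ofRealCLM.hasDerivAt (x := t)).add_const _
    have h3 := h1.comp t h2
    rw [mul_one] at h3
    exact h3
  have hc : ContinuousOn (fun t : ℝ => derivAt f t β) (uIcc a b) := by
    refine (continuousOn_deriv hf).comp (by fun_prop) fun t ht => ?_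
    rw [uIcc_of_le hab] at ht
    exact mem_halfPlane (lt_of_lt_of_le ha ht.1) β
  rw [← intervalIntegral.integral_eq_sub_of_hasDerivAt hd hc.intervalIntegrable,
    intervalIntegral.integral_of_le hab]
  refine (enorm_integral_le_lintegral_enorm _).trans ?_
  refine (lintegral_mono_set Ioc_subset_Ioi_self).trans (lintegral_mono fun α => ?_)
  exact le_iSup (fun β : ℝ => ‖derivAt f α β‖ₑ) β

theorem tendsto_tail {f : halfPlane → ℂ} (hf : IsBesov f) :
    Tendsto (fun a : ℝ => ∫⁻ α in Ioi a, ⨆ β : ℝ, ‖derivAt f α β‖ₑ) atTop (𝓝 0) := by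
  set μ := (volume.restrict (Ioi (0 : ℝ))).withDensity
    (fun α => ⨆ β : ℝ, ‖derivAt f α β‖ₑ) with hμ
  have hfin : IsFiniteMeasure μ := ⟨by
    rw [hμ, withDensity_apply _ MeasurableSet.univ, Measure.restrict_univ]; exact hf.2⟩
  have h := tendsto_measure_iInter_atTop (μ := μ) (s := fun a : ℝ => Ioi a)
    (fun a => measurableSet_Ioi.nullMeasurableSet) (fun a b h => Ioi_subset_Ioi h)
    ⟨0, measure_ne_top _ _⟩
  have he : (⋂ a : ℝ, Ioi a) = ∅ := by
    ext x; simp only [mem_iInter, mem_Ioi, mem_empty_iff_false, iff_false, not_forall, not_lt]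
    exact ⟨x, le_rfl⟩
  rw [he, measure_empty] at h
  refine h.congr' ?_
  filter_upwards [eventually_ge_atTop (0 : ℝ)] with a ha
  rw [Function.comp_apply, hμ, withDensity_apply _ measurableSet_Ioi, Measure.restrict_restrict measurableSet_Ioi,
    inter_eq_left.2 (Ioi_subset_Ioi ha)]

/-- A Besov function has a limit `L` as `Re z → ∞`, and `|f(a + iβ) - L|` is at most the tail of
the seminorm beyond `a`. -/
theorem exists_limit {f : halfPlane → ℂ} (hf : IsBesov f) :
    ∃ L : ℂ, ∀ a : ℝ, 0 < a → ∀ β : ℝ, ‖extend f (a + β * Complex.I) - L‖ₑ ≤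
      ∫⁻ α in Ioi a, ⨆ β : ℝ, ‖derivAt f α β‖ₑ := by
  set s : ℝ → ℝ≥0∞ := fun α => ⨆ β : ℝ, ‖derivAt f α β‖ₑ with hs
  have htail := tendsto_tail hf
  -- existence of the limit on each horizontal line
  have hlim : ∀ β : ℝ, ∃ L : ℂ,
      Tendsto (fun t : ℝ => extend f (t + β * Complex.I)) atTop (𝓝 L) := by
    intro β
    refine cauchy_map_iff_exists_tendsto.1 ?_
    refine Metric.cauchy_iff.2 ⟨inferInstance, fun ε hε => ?_⟩
    have h1 : ∀ᶠ a : ℝ in atTop, (∫⁻ α in Ioi a, s α) < ENNReal.ofReal (ε / 2) :=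
      htail.eventually (gt_mem_nhds (by simpa using hε))
    obtain ⟨a, ha, ha0⟩ := (h1.and (eventually_gt_atTop 0)).exists
    refine ⟨_, image_mem_map (Ici_mem_atTop a), ?_⟩
    have key : ∀ t ∈ Ici a, dist (extend f (t + β * Complex.I))
        (extend f (a + β * Complex.I)) < ε / 2 := by
      intro t ht
      have := (enorm_sub_le hf.1 ha0 ht β).trans_lt ha
      rw [← ofReal_norm, ENNReal.ofReal_lt_ofReal_iff (by positivity)] at this
      rwa [dist_eq_norm]
    rintro _ ⟨t, ht, rfl⟩ _ ⟨u, hu, rfl⟩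
    have := dist_triangle_right (extend f (t + β * Complex.I)) (extend f (u + β * Complex.I))
      (extend f (a + β * Complex.I))
    linarith [key t ht, key u hu]
  choose L hL using hlim
  -- the limits on different lines agree
  have hfreq : ∀ ε : ℝ≥0∞, 0 < ε → ∀ N : ℝ, 0 < N → ∃ α > N, s α < ε := by
    intro ε hε N hN
    by_contra! hcon
    have h1 : (∫⁻ _ in Ioi N, ε) ≤ ∫⁻ α in Ioi N, s α :=
      setLIntegral_mono' measurableSet_Ioi hcon
    have h2 : (∫⁻ α in Ioi N, s α) ≤ ∫⁻ α in Ioi 0, s α :=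
      lintegral_mono_set (Ioi_subset_Ioi hN.le)
    have h3 : (∫⁻ _ in Ioi N, ε) = ⊤ := by
      simp [ENNReal.mul_top hε.ne']
    rw [h3] at h1
    exact absurd hf.2 (not_lt.2 (h1.trans h2))
  have heq : ∀ β : ℝ, L β = L 0 := by
    intro β
    by_contra hne
    have hpos : 0 < dist (L β) (L 0) := dist_pos.2 hne
    have hd : Tendsto (fun t : ℝ => dist (extend f (t + β * Complex.I))
        (extend f (t + (0 : ℝ) * Complex.I))) atTop (𝓝 (dist (L β) (L 0))) :=
      (hL β).dist (hL 0)
    obtain ⟨N, hN⟩ := (eventually_atTop.1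
      ((hd.eventually (lt_mem_nhds (half_lt_self hpos))).and (eventually_gt_atTop 0)))
    obtain ⟨α, hα, hsα⟩ := hfreq (ENNReal.ofReal (dist (L β) (L 0) / 2 / (|β| + 1)))
      (by simp; positivity) N (hN N le_rfl).2
    have hα0 : 0 < α := (hN α hα.le).2
    have hbound : ∀ y ∈ (univ : Set ℝ), ‖derivAt f α y * Complex.I‖ ≤
        dist (L β) (L 0) / 2 / (|β| + 1) := by
      intro y _
      have h1 : ‖derivAt f α y‖ₑ ≤ s α := le_iSup (fun β : ℝ => ‖derivAt f α β‖ₑ) y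
      have h2 := h1.trans_lt hsα
      rw [← ofReal_norm, ENNReal.ofReal_lt_ofReal_iff (by positivity)] at h2
      simpa using h2.le
    have hder : ∀ y ∈ (univ : Set ℝ), HasDerivWithinAt
        (fun y : ℝ => extend f (α + y * Complex.I)) (derivAt f α y * Complex.I) univ y := by
      intro y _
      have hm := mem_halfPlane hα0 y
      have h1 := ((hf.1 _ hm).differentiableAt (isOpen_halfPlane.mem_nhds hm)).hasDerivAt
      have h2 : HasDerivAt (fun y : ℝ => (α + y * Complex.I : ℂ)) Complex.I y := by
        simpa using ((Complex.ofRealCLM.hasDerivAt (x := y)).mul_const Complex.I).const_add (α : ℂ)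
      exact (h1.comp y h2).hasDerivWithinAt
    have hmv := convex_univ.norm_image_sub_le_of_norm_hasDerivWithin_le hder hbound
      (mem_univ 0) (mem_univ β)
    rw [sub_zero, ← dist_eq_norm, Real.norm_eq_abs] at hmv
    have h3 := (hN α hα.le).1
    have h4 : dist (L β) (L 0) / 2 / (|β| + 1) * |β| ≤ dist (L β) (L 0) / 2 := by
      rw [div_mul_eq_mul_div, div_le_iff₀ (by positivity)]
      nlinarith [abs_nonneg β]
    linarith
  refine ⟨L 0, fun a ha β => ?_⟩
  have h1 : Tendsto (fun t : ℝ => ‖extend f (t + β * Complex.I)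
      - extend f (a + β * Complex.I)‖ₑ) atTop (𝓝 ‖L 0 - extend f (a + β * Complex.I)‖ₑ) :=
    (continuous_enorm.tendsto _).comp ((heq β ▸ hL β).sub_const _)
  rw [← enorm_neg, neg_sub]
  refine le_of_tendsto h1 ?_
  filter_upwards [eventually_ge_atTop a] with t ht
  exact enorm_sub_le hf.1 ha ht β

theorem coe_eq (z : halfPlane) : ((z : ℂ).re + (z : ℂ).im * Complex.I : ℂ) = z :=
  Complex.re_add_im _

/-- The limit defining `f(∞)` exists. -/
theorem tendsto_valueAtInfty {f : halfPlane → ℂ} (hf : IsBesov f) :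
    Tendsto f reAtTop (𝓝 (valueAtInfty f)) := by
  obtain ⟨L, hL⟩ := exists_limit hf
  refine tendsto_nhds_limUnder ⟨L, ?_⟩
  rw [tendsto_iff_edist_tendsto_0]
  refine tendsto_of_tendsto_of_tendsto_of_le_of_le tendsto_const_nhds
    ((tendsto_tail hf).comp (tendsto_comap : Tendsto (fun z : halfPlane => (z : ℂ).re) reAtTop _))
    (fun _ => bot_le) fun z => ?_
  have := hL (z : ℂ).re z.2 (z : ℂ).im
  rwa [coe_eq, extend_coe, ← edist_eq_enorm_sub] at this

/-- Besov functions are bounded. -/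
theorem exists_bound {f : halfPlane → ℂ} (hf : IsBesov f) :
    ∃ K : ℝ≥0∞, K ≠ ⊤ ∧ ∀ z : halfPlane, ‖f z‖ₑ ≤ K := by
  obtain ⟨L, hL⟩ := exists_limit hf
  refine ⟨besovSeminorm f + ‖L‖ₑ, ENNReal.add_ne_top.2 ⟨hf.2.ne, enorm_ne_top⟩, fun z => ?_⟩
  have h := hL (z : ℂ).re z.2 (z : ℂ).im
  rw [coe_eq, extend_coe] at h
  have h2 : (∫⁻ α in Ioi (z : ℂ).re, ⨆ β : ℝ, ‖derivAt f α β‖ₑ) ≤ besovSeminorm f :=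
    lintegral_mono_set (Ioi_subset_Ioi (le_of_lt z.2))
  calc ‖f z‖ₑ = ‖(f z - L) + L‖ₑ := by rw [sub_add_cancel]
    _ ≤ ‖f z - L‖ₑ + ‖L‖ₑ := enorm_add_le _ _
    _ ≤ _ := by gcongr; exact h.trans h2

theorem isBesov_const (c : ℂ) : IsBesov (fun _ => c) := by
  have h : ∀ z : halfPlane, (fun _ : halfPlane => c) z = (fun _ : ℂ => c) z := fun _ => rfl
  refine ⟨(differentiableOn_const c).congr (extend_eqOn _ _ h), ?_⟩
  have : besovSeminorm (fun _ => c) = ∫⁻ _ in Ioi (0 : ℝ), 0 :=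
    setLIntegral_congr_fun measurableSet_Ioi fun α hα => by
      have h0 : ∀ β : ℝ, derivAt (fun _ => c) α β = 0 := fun β => by
        rw [derivAt_eq (fun _ => c) (fun _ => c) h (mem_Ioi.1 hα), deriv_const]
      simp [h0]
  rw [this]; simp

theorem hasDerivAt_extend {f : halfPlane → ℂ} (hf : IsBesov f) {α : ℝ} (hα : 0 < α) (β : ℝ) :
    HasDerivAt (extend f) (derivAt f α β) (α + β * Complex.I) :=
  ((hf.1 _ (mem_halfPlane hα β)).differentiableAt
    (isOpen_halfPlane.mem_nhds (mem_halfPlane hα β))).hasDerivAt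

theorem isBesov_add {f g : halfPlane → ℂ} (hf : IsBesov f) (hg : IsBesov g) :
    IsBesov (f + g) := by
  have h : ∀ z : halfPlane, (f + g) z = (extend f + extend g) z := fun z => by
    simp [extend_coe]
  refine ⟨(hf.1.add hg.1).congr (extend_eqOn _ _ h), ?_⟩
  have hle : besovSeminorm (f + g) ≤ besovSeminorm f + besovSeminorm g := by
    unfold besovSeminorm
    rw [← lintegral_add_left' (aemeasurable_sup hf.1)]
    refine setLIntegral_mono' measurableSet_Ioi fun α hα => iSup_le fun β => ?_
    rw [derivAt_eq _ _ h hα,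
      ((hasDerivAt_extend hf hα β).add (hasDerivAt_extend hg hα β)).deriv]
    exact (enorm_add_le _ _).trans (add_le_add (le_iSup (fun β : ℝ => ‖derivAt f α β‖ₑ) β)
      (le_iSup (fun β : ℝ => ‖derivAt g α β‖ₑ) β))
  exact hle.trans_lt (ENNReal.add_lt_top.2 ⟨hf.2, hg.2⟩)

theorem isBesov_mul {f g : halfPlane → ℂ} (hf : IsBesov f) (hg : IsBesov g) :
    IsBesov (f * g) := by
  have h : ∀ z : halfPlane, (f * g) z = (extend f * extend g) z := fun z => by
    simp [extend_coe]
  refine ⟨(hf.1.mul hg.1).congr (extend_eqOn _ _ h), ?_⟩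
  obtain ⟨K, hK, hKf⟩ := exists_bound hf
  obtain ⟨K', hK', hKg⟩ := exists_bound hg
  have hle : besovSeminorm (f * g) ≤ K' * besovSeminorm f + K * besovSeminorm g := by
    unfold besovSeminorm
    rw [← lintegral_const_mul' _ _ hK, ← lintegral_const_mul' _ _ hK',
      ← lintegral_add_left' ((aemeasurable_sup hf.1).const_mul _)]
    refine setLIntegral_mono' measurableSet_Ioi fun α hα => iSup_le fun β => ?_
    have e1 := hKf ⟨_, mem_halfPlane hα β⟩
    have e2 := hKg ⟨_, mem_halfPlane hα β⟩
    rw [← extend_coe f] at e1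
    rw [← extend_coe g] at e2
    rw [derivAt_eq _ _ h hα,
      ((hasDerivAt_extend hf hα β).mul (hasDerivAt_extend hg hα β)).deriv]
    refine (enorm_add_le _ _).trans ?_
    rw [enorm_mul, enorm_mul, mul_comm ‖derivAt f α β‖ₑ]
    exact add_le_add (mul_le_mul' e2 (le_iSup (fun β : ℝ => ‖derivAt f α β‖ₑ) β))
      (mul_le_mul' e1 (le_iSup (fun β : ℝ => ‖derivAt g α β‖ₑ) β))
  exact hle.trans_lt (ENNReal.add_lt_top.2
    ⟨ENNReal.mul_lt_top hK'.lt_top hf.2, ENNReal.mul_lt_top hK.lt_top hg.2⟩)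

theorem isBesov_resolventFun (z : halfPlane) :
    IsBesov (fun w : halfPlane => ((w : ℂ) + z)⁻¹) := by
  have hz : 0 < (z : ℂ).re := z.2
  have h : ∀ w : halfPlane, (fun w : halfPlane => ((w : ℂ) + z)⁻¹) w
      = (fun w : ℂ => (w + z)⁻¹) w := fun _ => rfl
  have hne : ∀ w ∈ halfPlane, w + (z : ℂ) ≠ 0 := fun w hw h0 => by
    have h1 := congrArg Complex.re h0
    have h2 : 0 < w.re := hw
    simp only [Complex.add_re, Complex.zero_re] at h1
    linarith
  have hd : ∀ w ∈ halfPlane, HasDerivAt (fun w : ℂ => (w + z)⁻¹) (-1 / (w + z) ^ 2) w :=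
    fun w hw => ((hasDerivAt_id w).add_const (z : ℂ)).inv (hne w hw)
  refine ⟨DifferentiableOn.congr
    (fun w hw => (hd w hw).differentiableAt.differentiableWithinAt) (extend_eqOn _ _ h), ?_⟩
  have hint : IntegrableOn (fun α : ℝ => (α + (z : ℂ).re) ^ (-2 : ℝ)) (Ioi 0) := by
    have h3 := integrableOn_add_rpow_Ioi_of_lt (a := -2) (c := 0) (m := (z : ℂ).re)
      (by norm_num) (by linarith)
    exact h3
  refine lt_of_le_of_lt (setLIntegral_mono' measurableSet_Ioi fun α hα => iSup_le fun β => ?_)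
    hint.2
  rw [derivAt_eq (fun w : halfPlane => ((w : ℂ) + z)⁻¹) (fun w : ℂ => (w + z)⁻¹) h hα,
    (hd _ (mem_halfPlane hα β)).deriv]
  have hα' : 0 < α := hα
  have hp : 0 < α + (z : ℂ).re := by linarith
  rw [enorm_le_iff_norm_le, norm_div, norm_neg, norm_one, norm_pow, Real.norm_of_nonneg
    (Real.rpow_nonneg hp.le _), Real.rpow_neg hp.le, one_div]
  norm_num
  refine inv_anti₀ (by positivity) ?_
  refine pow_le_pow_left₀ hp.le ?_ 2
  have := Complex.re_le_norm (α + β * Complex.I + z)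
  simpa using this

/-- The algebra of analytic Besov functions on the right half-plane, with pointwise operations. -/
noncomputable def besov : Subalgebra ℂ (halfPlane → ℂ) where
  carrier := {f | IsBesov f}
  mul_mem' := isBesov_mul
  add_mem' := isBesov_add
  algebraMap_mem' := isBesov_const

/-- The function `w ↦ (w + z)⁻¹` for `Re z > 0`, as an element of the algebra. -/
noncomputable def resolventFun (z : halfPlane) : besov :=
  ⟨fun w => ((w : ℂ) + z)⁻¹, isBesov_resolventFun z⟩

/-! ## Unbounded operators -/

section Operator

variable {X : Type*} [NormedAddCommGroup X] [NormedSpace ℂ X]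

/-- `R` is a bounded two-sided inverse of `z + A : D(A) → X`. -/
def IsShiftInverse (A : X →ₗ.[ℂ] X) (z : ℂ) (R : X →L[ℂ] X) : Prop :=
  (∀ x : X, ∃ h : R x ∈ A.domain, z • R x + A ⟨R x, h⟩ = x) ∧
    ∀ x : A.domain, R (z • (x : X) + A x) = x

/-- The spectrum of `A`: all `l` such that `l - A` has no bounded inverse (equivalently,
such that `-l + A` has none). -/
def spectrumOf (A : X →ₗ.[ℂ] X) : Set ℂ :=
  {l | ¬ ∃ R : X →L[ℂ] X, IsShiftInverse A (-l) R}

/-- `(z + A)⁻¹` if `-z` is in the resolvent set of `A` (and `0` otherwise). -/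
noncomputable def shiftInv (A : X →ₗ.[ℂ] X) (z : ℂ) : X →L[ℂ] X :=
  open Classical in if h : ∃ R : X →L[ℂ] X, IsShiftInverse A z R then h.choose else 0

theorem IsShiftInverse.unique {A : X →ₗ.[ℂ] X} {z : ℂ} {R S : X →L[ℂ] X}
    (hR : IsShiftInverse A z R) (hS : IsShiftInverse A z S) : R = S := by
  ext x
  obtain ⟨h, hx⟩ := hR.1 x
  have := hS.2 ⟨R x, h⟩
  change S (z • R x + A ⟨R x, h⟩) = R x at this
  rw [hx] at this
  exact this.symm

theorem IsShiftInverse.shiftInv_eq {A : X →ₗ.[ℂ] X} {z : ℂ} {R : X →L[ℂ] X}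
    (hR : IsShiftInverse A z R) : shiftInv A z = R := by
  have h : ∃ R : X →L[ℂ] X, IsShiftInverse A z R := ⟨R, hR⟩
  rw [shiftInv, dif_pos h]
  exact h.choose_spec.unique hR

/-- The open sector `{z ≠ 0 : |arg z| < θ}`, and `(0, ∞)` if `θ = 0`. -/
noncomputable def sector (θ : ℝ) : Set ℂ :=
  open Classical in
  if θ = 0 then {z | 0 < z.re ∧ z.im = 0} else {z | z ≠ 0 ∧ |z.arg| < θ}

/-- `M_ψ(A) = sup { ‖z (z + A)⁻¹‖ : z ∈ Σ_{π - ψ} }`, possibly infinite. -/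
noncomputable def sectorSup (A : X →ₗ.[ℂ] X) (ψ : ℝ) : ℝ≥0∞ :=
  ⨆ z ∈ sector (Real.pi - ψ), ‖z • shiftInv A z‖ₑ

/-- `A` is sectorial of angle `θ`. -/
def IsSectorial (A : X →ₗ.[ℂ] X) (θ : ℝ) : Prop :=
  spectrumOf A ⊆ closure (sector θ) ∧ ∀ ψ : ℝ, θ < ψ → ψ < Real.pi → sectorSup A ψ < ⊤

/-- `A` is sectorial of some angle in `[0, π/2)`. -/
def IsSectorialLTPiDivTwo (A : X →ₗ.[ℂ] X) : Prop :=
  ∃ θ : ℝ, 0 ≤ θ ∧ θ < Real.pi / 2 ∧ IsSectorial A θ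

/-- The sectoriality constant `M_A = M_{π/2}(A) = sup_{Re z > 0} ‖z (z + A)⁻¹‖`. -/
noncomputable def sectConst (A : X →ₗ.[ℂ] X) : ℝ :=
  (sectorSup A (Real.pi / 2)).toReal

/-- `⟨(α + iβ + A)⁻² x, x*⟩`. -/
noncomputable def resolventSq (A : X →ₗ.[ℂ] X) (x : X) (x' : StrongDual ℂ X) (α β : ℝ) : ℂ :=
  x' ((shiftInv A (α + β * Complex.I) ^ 2) x)

/-- The Gomilko--Shi--Feng assumptions. -/
def SatisfiesGSF (A : X →ₗ.[ℂ] X) : Prop :=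
  spectrumOf A ⊆ {z | 0 ≤ z.re} ∧
    ∀ (x : X) (x' : StrongDual ℂ X),
      (⨆ α ∈ Ioi (0 : ℝ), ENNReal.ofReal α * (∫⁻ β : ℝ, ‖resolventSq A x x' α β‖ₑ)) < ⊤

/-- The minimal constant `γ_A` such that
`∫ |⟨(α + iβ + A)⁻² x, x*⟩| dβ ≤ (γ_A / α) ‖x‖ ‖x*‖` for all `α > 0`, `x`, `x*`
(and `∞` if there is no finite one). -/
noncomputable def gsfConst (A : X →ₗ.[ℂ] X) : ℝ≥0∞ :=
  sInf {γ | ∀ α : ℝ, 0 < α → ∀ (x : X) (x' : StrongDual ℂ X),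
    (∫⁻ β : ℝ, ‖resolventSq A x x' α β‖ₑ) ≤ γ / ENNReal.ofReal α * ‖x‖ₑ * ‖x'‖ₑ}

/-- A Besov calculus for `A`: an algebra homomorphism which is bounded for the Besov norm and
maps `w ↦ (w + z)⁻¹` to `(z + A)⁻¹` whenever `Re z > 0`. -/
def IsBesovCalculus (A : X →ₗ.[ℂ] X) (Φ : besov →ₐ[ℂ] (X →L[ℂ] X)) : Prop :=
  (∃ K : ℝ, ∀ f : besov, ‖Φ f‖ ≤ K * besovNorm f) ∧
    ∀ z : halfPlane, Φ (resolventFun z) = shiftInv A z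

/-- `T = f(A)` in the sense of the weakly convergent reproducing formula: for all `x`, `x*`,
`⟨T x, x*⟩ = f(∞) ⟨x, x*⟩ - (2/π) ∫₀^∞ α ∫_ℝ ⟨(α - iβ + A)⁻² x, x*⟩ f'(α + iβ) dβ dα`,
with an absolutely convergent integral. This determines `T` uniquely. -/
def IsWeakValue (A : X →ₗ.[ℂ] X) (f : besov) (T : X →L[ℂ] X) : Prop :=
  ∀ (x : X) (x' : StrongDual ℂ X),
    IntegrableOn (fun p : ℝ × ℝ => (p.1 : ℂ) *
      (resolventSq A x x' p.1 (-p.2) * derivAt f p.1 p.2)) (Ioi 0 ×ˢ univ) ∧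
    x' (T x) = valueAtInfty f * x' x - (2 / Real.pi : ℂ) *
      ∫ α in Ioi (0 : ℝ), (α : ℂ) * ∫ β : ℝ, resolventSq A x x' α (-β) * derivAt f α β

/-- The operator-valued integrand `f'(α + iβ) (α - iβ + A)⁻²`. -/
noncomputable def opIntegrand (A : X →ₗ.[ℂ] X) (f : besov) (α β : ℝ) : X →L[ℂ] X :=
  derivAt f α β • shiftInv A (α - β * Complex.I) ^ 2

end Operator

end BesovCalculus

open BesovCalculus

/-!
# The Besov calculus of sectorial operators

Write `R(z) = (z + A)⁻¹` and `M = M_A`, so that `‖R(z)‖ ≤ M / |z|` for `Re z > 0`.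

**The constant.** Besides the trivial bound `‖R(z)²‖ ≤ M² / |z|²` there is Cauchy's estimate for
`R(z)² = -R'(z)` on the disc of radius `Re z / 2`, which gives `‖R(z)²‖ ≤ 4M / (Re z |z|)`
(`IsHalfPlaneResolvent.norm_sq_le_of_cauchy`). On the line `Re z = α` the second bound is used for
`|Im z| ≤ Mα`, where it produces the logarithm, and the first one beyond; this yields
`∫ ‖R(α + iβ)²‖ dβ ≤ 10 M (log M + 1) / α` (`IsHalfPlaneResolvent.lintegral_norm_sq_le`), hence the
GSF assumptions, the bound on `γ_A`, and the absolute convergence and the norm bound for `f(A)`.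

**Reproducing formula.** Cauchy's formula for a half-plane (`integral_line_sq_inv_smul`) and an
integration by parts in the real part give, for holomorphic `h` with suitable decay,
`h(z) = h(∞) - (2/π) ∫ α (α - iβ + z)⁻² h'(α + iβ)` (`reproducing`). It holds for Banach space
valued `h`. With `h = f` it represents a Besov function; with `h = R` it says that the calculus takes
`z ↦ (z + a)⁻¹` to `R(a)` (`besovCalc_shiftedInv`).

**Multiplicativity.** Put `k_w(z) = (z + w̄)⁻²`. Inserting the reproducing formula of `f` into the
integral that defines the calculus at `f * g` produces an absolutely convergent double integral
(`integrable_doubleIntegrand`), and Fubini's theorem reduces `(f g)(A) = f(A) g(A)` to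
`(k_w g)(A) = R(w̄)² g(A)` (`besovCalc_mul_of_kernel`). Applied with the roles of the factors
exchanged, the same reduction leaves only `(k_w k_v)(A) = R(w̄)² R(v̄)²` for `w ≠ v`, which follows
from partial fractions and the resolvent identity. All this uses only the resolvent identity and the
bound on `R`, so it is carried out for resolvent families in a Banach algebra.
-/

namespace BesovCalculus

/-! ### Integrals over vertical lines -/

theorem integrable_inv_sq_add_sq {c : ℝ} (hc : 0 < c) (b : ℝ) :
    Integrable (fun β : ℝ => (c ^ 2 + (β - b) ^ 2)⁻¹) := by
  have h := ((integrable_inv_one_add_sq.comp_div hc.ne').comp_sub_right b).const_mul ((c ^ 2)⁻¹)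
  refine h.congr (ae_of_all _ fun β => ?_)
  simp only
  rw [← mul_inv]
  congr 1
  field_simp

theorem integral_inv_sq_add_sq {c : ℝ} (hc : 0 < c) (b : ℝ) :
    ∫ β : ℝ, (c ^ 2 + (β - b) ^ 2)⁻¹ = Real.pi / c := by
  have h : ∀ β : ℝ, (c ^ 2 + (β - b) ^ 2)⁻¹ = (c ^ 2)⁻¹ * (1 + ((β - b) / c) ^ 2)⁻¹ := by
    intro β
    rw [← mul_inv]
    congr 1
    field_simp
  simp_rw [h]
  rw [integral_const_mul, integral_sub_right_eq_self (fun β : ℝ => (1 + (β / c) ^ 2)⁻¹) b,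
    Measure.integral_comp_div (fun β : ℝ => (1 + β ^ 2)⁻¹) c, integral_univ_inv_one_add_sq,
    abs_of_pos hc, smul_eq_mul]
  field_simp

theorem lintegral_inv_sq_add_sq {c : ℝ} (hc : 0 < c) (b : ℝ) :
    ∫⁻ β : ℝ, ENNReal.ofReal (c ^ 2 + (β - b) ^ 2)⁻¹ = ENNReal.ofReal (Real.pi / c) := by
  rw [← integral_inv_sq_add_sq hc b, ofReal_integral_eq_lintegral_ofReal
    (integrable_inv_sq_add_sq hc b) (ae_of_all _ fun β => by positivity)]

theorem sq_norm_line_sub (a β : ℝ) (ζ : ℂ) :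
    ‖(a + β * Complex.I : ℂ) - ζ‖ ^ 2 = (ζ.re - a) ^ 2 + (β - ζ.im) ^ 2 := by
  rw [Complex.sq_norm, Complex.normSq_apply]
  simp
  ring

section Cauchy

variable {E : Type*} [NormedAddCommGroup E] [NormedSpace ℂ E]

/-- Cauchy's theorem on the rectangles with sides `Re z = a`, `Re z = Re ζ + T` and
`Im z = Im ζ ± T`: by the quadratic decay only the side on the line `Re z = a` survives as
`T → ∞`. -/
theorem integral_vertical_eq_zero {H : ℂ → E} {a K : ℝ} {ζ : ℂ} (hζ : a < ζ.re)
    (hd : DifferentiableOn ℂ H {z | a ≤ z.re})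
    (hK : ∀ z : ℂ, a ≤ z.re → z ≠ ζ → ‖H z‖ ≤ K / ‖z - ζ‖ ^ 2)
    (hint : Integrable fun β : ℝ => H (a + β * Complex.I)) :
    ∫ β : ℝ, H (a + β * Complex.I) = 0 := by
  have hlim : Tendsto (fun T : ℝ => ∫ β in (ζ.im - T)..(ζ.im + T), H (a + β * Complex.I)) atTop
      (𝓝 (∫ β : ℝ, H (a + β * Complex.I))) :=
    intervalIntegral_tendsto_integral hint
      (tendsto_atBot_add_const_left _ _ tendsto_neg_atTop_atBot)
      (tendsto_atTop_add_const_left _ _ tendsto_id)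
  have hbd : ∀ T : ℝ, 0 < T → ‖∫ β in (ζ.im - T)..(ζ.im + T), H (a + β * Complex.I)‖ ≤
      4 * |K| / T + 2 * |K| * (ζ.re - a) / T ^ 2 := by
    intro T hT
    have hr := Complex.integral_boundary_rect_eq_zero_of_differentiableOn H
      (a + (ζ.im - T : ℝ) * Complex.I) ((ζ.re + T : ℝ) + (ζ.im + T : ℝ) * Complex.I) (by
        refine hd.mono fun z hz => ?_
        have h1 := hz.1
        simp only [Complex.add_re, Complex.ofReal_re, Complex.mul_re, Complex.I_re, mul_zero,
          Complex.ofReal_im, Complex.I_im, mul_one, sub_self, add_zero, mem_preimage] at h1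
        rw [uIcc_of_le (by linarith)] at h1
        exact h1.1)
    simp only [Complex.add_re, Complex.ofReal_re, Complex.mul_re, Complex.I_re, mul_zero,
          Complex.ofReal_im, Complex.I_im, mul_one, sub_self, add_zero, Complex.add_im,
          Complex.mul_im, zero_add] at hr
    have hsup : ∀ z : ℂ, a ≤ z.re → T ≤ ‖z - ζ‖ → ‖H z‖ ≤ |K| / T ^ 2 := by
      intro z hz hzT
      have hne : z ≠ ζ := by
        rintro rfl
        simp at hzT
        linarith
      refine (hK z hz hne).trans ?_
      gcongr
      exact le_abs_self K
    have e1 : ‖∫ x : ℝ in a..(ζ.re + T), H (x + (ζ.im - T : ℝ) * Complex.I)‖ ≤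
        |K| / T ^ 2 * |ζ.re + T - a| := by
      refine intervalIntegral.norm_integral_le_of_norm_le_const fun x hx => hsup _ ?_ ?_
      · rw [uIoc_of_le (by linarith)] at hx
        simpa using hx.1.le
      · refine le_trans (le_of_eq ?_) (Complex.abs_im_le_norm _)
        simp [abs_of_pos hT]
    have e2 : ‖∫ x : ℝ in a..(ζ.re + T), H (x + (ζ.im + T : ℝ) * Complex.I)‖ ≤
        |K| / T ^ 2 * |ζ.re + T - a| := by
      refine intervalIntegral.norm_integral_le_of_norm_le_const fun x hx => hsup _ ?_ ?_
      · rw [uIoc_of_le (by linarith)] at hx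
        simpa using hx.1.le
      · refine le_trans (le_of_eq ?_) (Complex.abs_im_le_norm _)
        simp [abs_of_pos hT]
    have e3 : ‖∫ y : ℝ in (ζ.im - T)..(ζ.im + T), H ((ζ.re + T : ℝ) + y * Complex.I)‖ ≤
        |K| / T ^ 2 * |ζ.im + T - (ζ.im - T)| := by
      refine intervalIntegral.norm_integral_le_of_norm_le_const fun x hx => hsup _ ?_ ?_
      · simp
        linarith
      · refine le_trans (le_of_eq ?_) (Complex.abs_re_le_norm _)
        simp [abs_of_pos hT]
    rw [sub_eq_zero] at hr
    have h4 : ‖∫ β in (ζ.im - T)..(ζ.im + T), H (a + β * Complex.I)‖ =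
        ‖Complex.I • ∫ β in (ζ.im - T)..(ζ.im + T), H (a + β * Complex.I)‖ := by
      simp [norm_smul]
    rw [h4, ← hr]
    refine (norm_add_le _ _).trans ((add_le_add (norm_sub_le _ _) le_rfl).trans ?_)
    rw [norm_smul, Complex.norm_I, one_mul]
    refine (add_le_add (add_le_add e1 e2) e3).trans (le_of_eq ?_)
    rw [abs_of_pos (by linarith : 0 < ζ.re + T - a),
      abs_of_pos (by linarith : 0 < ζ.im + T - (ζ.im - T))]
    field_simp
    ring
  have h0 : Tendsto (fun T : ℝ => 4 * |K| / T + 2 * |K| * (ζ.re - a) / T ^ 2) atTop (𝓝 0) := by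
    simpa using (tendsto_const_nhds.div_atTop tendsto_id).add
      (tendsto_const_nhds.div_atTop (tendsto_pow_atTop (α := ℝ) two_ne_zero))
  exact tendsto_nhds_unique hlim (squeeze_zero_norm' ((eventually_gt_atTop 0).mono hbd) h0)

/-- Cauchy's formula for the derivative on a half-plane. The proof removes the double pole
at `ζ`; the simple pole that remains is cancelled by a pole at the reflection of `ζ` in the
line `Re z = a`, which lies outside the half-plane. -/
theorem integral_line_sq_inv_smul [CompleteSpace E] {F : ℂ → E} {a B : ℝ} {ζ : ℂ} (ha : 0 < a)
    (hζ : a < ζ.re) (hF : DifferentiableOn ℂ F halfPlane) (hB : ∀ z : ℂ, a ≤ z.re → ‖F z‖ ≤ B) :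
    ∫ β : ℝ, ((ζ - (a + β * Complex.I)) ^ 2)⁻¹ • F (a + β * Complex.I) =
      (-(2 * Real.pi) : ℂ) • deriv F ζ := by
  have hζ0 : halfPlane ∈ 𝓝 ζ := isOpen_halfPlane.mem_nhds (show 0 < ζ.re from ha.trans hζ)
  set c : ℝ := ζ.re - a with hc
  have hc0 : 0 < c := by linarith
  set ζ' : ℂ := (a - c : ℝ) + ζ.im * Complex.I with hζ'
  set D : ℂ → E := dslope (dslope F ζ) ζ with hD
  have hDd : DifferentiableOn ℂ D halfPlane :=
    (Complex.differentiableOn_dslope hζ0).2 ((Complex.differentiableOn_dslope hζ0).2 hF)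
  have hDeq : ∀ z, z ≠ ζ → D z = ((z - ζ) ^ 2)⁻¹ • (F z - F ζ) - (z - ζ)⁻¹ • deriv F ζ := by
    intro z hz
    rw [hD, dslope_of_ne _ hz, slope_def_module, dslope_of_ne _ hz, slope_def_module, dslope_same,
      smul_sub, smul_smul]
    congr 2
    rw [sq, mul_inv]
  have hne' : ∀ z : ℂ, a ≤ z.re → z - ζ' ≠ 0 := by
    intro z hz h0
    have := congrArg Complex.re h0
    simp [hζ'] at this
    linarith
  -- off `ζ` this is `F z / (z - ζ)²` corrected by the principal part and the reflected pole
  set H : ℂ → E := fun z => D z + (z - ζ')⁻¹ • deriv F ζ with hH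
  have hHd : DifferentiableOn ℂ H {z | a ≤ z.re} := by
    refine (hDd.mono fun z hz => lt_of_lt_of_le ha hz).add ?_
    exact (DifferentiableOn.inv (by fun_prop) fun z hz => hne' z hz).smul_const _
  have hζζ' : ζ - ζ' = (2 * c : ℝ) := by
    apply Complex.ext <;> simp [hζ', hc]
    ring
  have hHeq : ∀ z, a ≤ z.re → z ≠ ζ → H z = ((z - ζ) ^ 2)⁻¹ • (F z - F ζ) -
      ((2 * c : ℝ) * (z - ζ)⁻¹ * (z - ζ')⁻¹) • deriv F ζ := by
    intro z hz hzne
    have h1 : z - ζ ≠ 0 := sub_ne_zero.2 hzne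
    have h2 := hne' z hz
    simp only [hH]
    rw [hDeq z hzne, ← hζζ', sub_add, ← sub_smul]
    congr 2
    field_simp
    ring
  have hrefl : ∀ z : ℂ, a ≤ z.re → ‖z - ζ‖ ≤ ‖z - ζ'‖ := by
    intro z hz
    rw [← abs_of_nonneg (norm_nonneg (z - ζ)), ← abs_of_nonneg (norm_nonneg (z - ζ')), ← sq_le_sq,
      Complex.sq_norm, Complex.sq_norm, Complex.normSq_apply, Complex.normSq_apply]
    simp [hζ', hc]
    nlinarith
  have hline : ∀ β : ℝ, (a + β * Complex.I : ℂ) ≠ ζ := by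
    intro β h
    have := congrArg Complex.re h
    simp at this
    linarith
  have hlre : ∀ β : ℝ, a ≤ (a + β * Complex.I : ℂ).re := by intro β; simp
  have hnorm : ∀ β : ℝ, ‖(((a + β * Complex.I : ℂ) - ζ) ^ 2)⁻¹‖ = (c ^ 2 + (β - ζ.im) ^ 2)⁻¹ := by
    intro β
    rw [norm_inv, norm_pow, sq_norm_line_sub]
  have hcont : Continuous fun β : ℝ => (((a + β * Complex.I : ℂ) - ζ) ^ 2)⁻¹ :=
    Continuous.inv₀ (by fun_prop) fun β => pow_ne_zero 2 (sub_ne_zero.2 (hline β))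
  have hFc : Continuous fun β : ℝ => F (a + β * Complex.I) :=
    hF.continuousOn.comp_continuous (by fun_prop) fun β => mem_halfPlane ha β
  have hI1 : Integrable fun β : ℝ => (((a + β * Complex.I : ℂ) - ζ) ^ 2)⁻¹ := by
    refine (integrable_inv_sq_add_sq hc0 ζ.im).mono' hcont.aestronglyMeasurable
      (ae_of_all _ fun β => (hnorm β).le)
  have hI2 : Integrable fun β : ℝ => (((a + β * Complex.I : ℂ) - ζ) ^ 2)⁻¹ •
      F (a + β * Complex.I) := by
    refine ((integrable_inv_sq_add_sq hc0 ζ.im).mul_const B).mono'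
      (hcont.smul hFc).aestronglyMeasurable (ae_of_all _ fun β => ?_)
    rw [norm_smul, hnorm]
    gcongr
    exact hB _ (hlre β)
  have hprod : ∀ β : ℝ, ((2 * c : ℝ) : ℂ) * ((a + β * Complex.I : ℂ) - ζ)⁻¹ *
      ((a + β * Complex.I : ℂ) - ζ')⁻¹ = ((-(2 * c) * (c ^ 2 + (β - ζ.im) ^ 2)⁻¹ : ℝ) : ℂ) := by
    intro β
    have : ((a + β * Complex.I : ℂ) - ζ) * ((a + β * Complex.I : ℂ) - ζ') =
        ((-(c ^ 2 + (β - ζ.im) ^ 2) : ℝ) : ℂ) := by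
      apply Complex.ext
      · rw [Complex.ofReal_re, Complex.mul_re]
        simp [hζ', hc]
        ring
      · rw [Complex.ofReal_im, Complex.mul_im]
        simp [hζ', hc]
        ring
    rw [mul_assoc, ← mul_inv, this]
    push_cast
    rw [inv_neg]
    ring
  have hI3 : Integrable fun β : ℝ => ((2 * c : ℝ) : ℂ) * ((a + β * Complex.I : ℂ) - ζ)⁻¹ *
      ((a + β * Complex.I : ℂ) - ζ')⁻¹ := by
    simp_rw [hprod]
    exact ((integrable_inv_sq_add_sq hc0 ζ.im).const_mul _).ofReal
  have hzero : ∫ β : ℝ, (((a + β * Complex.I : ℂ) - ζ) ^ 2)⁻¹ = 0 := by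
    have hder : ∀ β : ℝ, HasDerivAt
        (fun β : ℝ => Complex.I * ((a + β * Complex.I : ℂ) - ζ)⁻¹)
        ((((a + β * Complex.I : ℂ) - ζ) ^ 2)⁻¹) β := by
      intro β
      have h1 : HasDerivAt (fun β : ℝ => (a + β * Complex.I : ℂ) - ζ) Complex.I β := by
        simpa using (((Complex.ofRealCLM.hasDerivAt (x := β)).mul_const Complex.I).const_add
          (a : ℂ)).sub_const ζ
      refine ((h1.inv (sub_ne_zero.2 (hline β))).const_mul Complex.I).congr_deriv ?_
      rw [mul_div_assoc', mul_neg, Complex.I_mul_I, neg_neg, one_div]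
    have hn : Tendsto (fun β : ℝ => ‖(a + β * Complex.I : ℂ) - ζ‖) (cocompact ℝ) atTop := by
      refine tendsto_atTop_mono (fun β => Complex.abs_im_le_norm _) ?_
      have : (fun β : ℝ => |((a + β * Complex.I : ℂ) - ζ).im|) = fun β : ℝ => ‖β - ζ.im‖ := by
        ext β; simp
      rw [this]
      exact (tendsto_norm_cocompact_atTop (E := ℝ)).comp
        ((Homeomorph.subRight ζ.im).isClosedEmbedding.tendsto_cocompact)
    have ht : Tendsto (fun β : ℝ => Complex.I * ((a + β * Complex.I : ℂ) - ζ)⁻¹) (cocompact ℝ)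
        (𝓝 0) := by
      rw [tendsto_zero_iff_norm_tendsto_zero]
      simp only [norm_mul, Complex.norm_I, one_mul, norm_inv]
      exact tendsto_inv_atTop_zero.comp hn
    have := integral_of_hasDerivAt_of_tendsto hder hI1 (ht.mono_left atBot_le_cocompact)
      (ht.mono_left atTop_le_cocompact)
    simpa using this
  have hIH : ∀ β : ℝ, H (a + β * Complex.I) =
      ((((a + β * Complex.I : ℂ) - ζ) ^ 2)⁻¹ • F (a + β * Complex.I) -
      (((a + β * Complex.I : ℂ) - ζ) ^ 2)⁻¹ • F ζ) -
      (((2 * c : ℝ) : ℂ) * ((a + β * Complex.I : ℂ) - ζ)⁻¹ *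
      ((a + β * Complex.I : ℂ) - ζ')⁻¹) • deriv F ζ := by
    intro β
    rw [hHeq _ (hlre β) (hline β), smul_sub]
  have hmain := integral_vertical_eq_zero (H := H) (a := a) (ζ := ζ)
    (K := 2 * B + 2 * c * ‖deriv F ζ‖) hζ hHd (by
      intro z hz hzne
      rw [hHeq z hz hzne]
      have hpos : 0 < ‖z - ζ‖ := norm_pos_iff.2 (sub_ne_zero.2 hzne)
      refine (norm_sub_le _ _).trans ?_
      rw [norm_smul, norm_smul, norm_mul, norm_mul, norm_inv, norm_inv, norm_inv, norm_pow,
        add_div, Complex.norm_real, Real.norm_of_nonneg (by positivity)]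
      refine add_le_add ?_ ?_
      · rw [div_eq_inv_mul]
        gcongr
        refine (norm_sub_le _ _).trans ?_
        linarith [hB z hz, hB ζ hζ.le]
      · have : ‖z - ζ'‖⁻¹ ≤ ‖z - ζ‖⁻¹ := inv_anti₀ hpos (hrefl z hz)
        calc 2 * c * ‖z - ζ‖⁻¹ * ‖z - ζ'‖⁻¹ * ‖deriv F ζ‖
            ≤ 2 * c * ‖z - ζ‖⁻¹ * ‖z - ζ‖⁻¹ * ‖deriv F ζ‖ := by gcongr
          _ = _ := by field_simp)
    (by
      simp_rw [hIH]
      exact (hI2.sub (hI1.smul_const _)).sub (hI3.smul_const _))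
  simp_rw [hIH] at hmain
  have hI12 : Integrable fun β : ℝ => (((a + β * Complex.I : ℂ) - ζ) ^ 2)⁻¹ •
      F (a + β * Complex.I) - (((a + β * Complex.I : ℂ) - ζ) ^ 2)⁻¹ • F ζ :=
    hI2.sub (hI1.smul_const _)
  rw [integral_sub hI12 (hI3.smul_const _), integral_sub hI2 (hI1.smul_const _),
    integral_smul_const, integral_smul_const, hzero,
    zero_smul, sub_zero, sub_eq_zero] at hmain
  have hsymm : ∀ β : ℝ, (ζ - (a + β * Complex.I : ℂ)) ^ 2 = ((a + β * Complex.I : ℂ) - ζ) ^ 2 :=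
    fun β => by ring
  simp_rw [hsymm]
  rw [hmain]
  simp_rw [hprod]
  rw [integral_complex_ofReal, integral_const_mul, integral_inv_sq_add_sq hc0]
  congr 1
  have : (c : ℂ) ≠ 0 := by exact_mod_cast hc0.ne'
  push_cast
  field_simp

end Cauchy

/-! ### The reproducing formula -/

/-- Lebesgue measure on the half-plane `α > 0`, in the coordinates `(α, β)` of `α + iβ`. -/
noncomputable def halfMeasure : Measure (ℝ × ℝ) := volume.restrict (Ioi 0 ×ˢ univ)

theorem halfMeasure_eq : halfMeasure = (volume.restrict (Ioi (0 : ℝ))).prod volume := by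
  rw [halfMeasure, Measure.volume_eq_prod, ← Measure.prod_restrict, Measure.restrict_univ]

instance : SFinite halfMeasure := by
  rw [halfMeasure]
  infer_instance

theorem measurableSet_half : MeasurableSet (Ioi (0 : ℝ) ×ˢ (univ : Set ℝ)) :=
  measurableSet_Ioi.prod MeasurableSet.univ

theorem ae_halfMeasure : ∀ᵐ p ∂halfMeasure, 0 < p.1 := by
  filter_upwards [ae_restrict_mem measurableSet_half] with p hp using hp.1

theorem ae_halfMeasure_ne (q : ℝ × ℝ) : ∀ᵐ p ∂halfMeasure, p ≠ q := by
  refine ae_restrict_of_ae ?_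
  rw [Measure.volume_eq_prod]
  exact Measure.ae_ne _ q

theorem aestronglyMeasurable_half {E : Type*} [TopologicalSpace E]
    [TopologicalSpace.PseudoMetrizableSpace E] {G : ℝ × ℝ → E}
    (hG : ContinuousOn G (Ioi 0 ×ˢ univ)) : AEStronglyMeasurable G halfMeasure :=
  hG.aestronglyMeasurable measurableSet_half

/-- Integration in `β` of the Poisson-like kernel `α / ((α + x)² + (β - b)²)`. -/
theorem lintegral_half_kernel {φ : ℝ → ℝ≥0∞} (hφ : AEMeasurable φ (volume.restrict (Ioi 0)))
    {x : ℝ} (hx : 0 ≤ x) (b : ℝ) :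
    ∫⁻ p, ENNReal.ofReal (p.1 * ((p.1 + x) ^ 2 + (p.2 - b) ^ 2)⁻¹) * φ p.1 ∂halfMeasure =
      ENNReal.ofReal Real.pi * ∫⁻ α in Ioi (0 : ℝ), ENNReal.ofReal (α / (α + x)) * φ α := by
  have hm : AEMeasurable (fun p : ℝ × ℝ => ENNReal.ofReal
      (p.1 * ((p.1 + x) ^ 2 + (p.2 - b) ^ 2)⁻¹) * φ p.1)
      ((volume.restrict (Ioi (0 : ℝ))).prod volume) :=
    AEMeasurable.mul (by fun_prop) hφ.comp_fst
  rw [halfMeasure_eq, lintegral_prod _ hm,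
    ← lintegral_const_mul' _ _ ENNReal.ofReal_ne_top]
  refine setLIntegral_congr_fun measurableSet_Ioi fun α hα => ?_
  have hα' : 0 < α := hα
  have hc : 0 < α + x := by linarith
  simp only
  rw [lintegral_mul_const _ (by fun_prop)]
  simp_rw [ENNReal.ofReal_mul hα'.le]
  rw [lintegral_const_mul _ (by fun_prop), lintegral_inv_sq_add_sq hc, ← mul_assoc,
    ← ENNReal.ofReal_mul hα'.le, ← ENNReal.ofReal_mul Real.pi_pos.le]
  congr 2
  ring

theorem lintegral_half_kernel_le {φ : ℝ → ℝ≥0∞} (hφ : AEMeasurable φ (volume.restrict (Ioi 0)))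
    {x : ℝ} (hx : 0 ≤ x) (b : ℝ) :
    ∫⁻ p, ENNReal.ofReal (p.1 * ((p.1 + x) ^ 2 + (p.2 - b) ^ 2)⁻¹) * φ p.1 ∂halfMeasure ≤
      ENNReal.ofReal Real.pi * ∫⁻ α in Ioi (0 : ℝ), φ α := by
  rw [lintegral_half_kernel hφ hx]
  refine mul_le_mul' le_rfl ?_
  refine setLIntegral_mono' measurableSet_Ioi fun α hα => ?_
  have hα' : 0 < α := hα
  refine (mul_le_mul' (ENNReal.ofReal_le_one.2 ?_) le_rfl).trans_eq (one_mul _)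
  exact div_le_one_of_le₀ (by linarith) (by linarith)

theorem integrable_half_of_le {E : Type*} [NormedAddCommGroup E] {G : ℝ × ℝ → E}
    (hG : ContinuousOn G (Ioi 0 ×ˢ univ)) {φ : ℝ → ℝ≥0∞}
    (hφ : AEMeasurable φ (volume.restrict (Ioi 0))) (hfin : ∫⁻ α in Ioi (0 : ℝ), φ α < ⊤)
    {x : ℝ} (hx : 0 ≤ x) (b : ℝ)
    (hb : ∀ p : ℝ × ℝ, 0 < p.1 →
      ‖G p‖ₑ ≤ ENNReal.ofReal (p.1 * ((p.1 + x) ^ 2 + (p.2 - b) ^ 2)⁻¹) * φ p.1) :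
    Integrable G halfMeasure := by
  refine ⟨aestronglyMeasurable_half hG, lt_of_le_of_lt (le_trans (lintegral_mono_ae ?_)
    (lintegral_half_kernel_le hφ hx b)) (ENNReal.mul_lt_top ENNReal.ofReal_lt_top hfin)⟩
  filter_upwards [ae_halfMeasure] with p hp using hb p hp

/-- The reproducing formula for holomorphic functions with values in a Banach space. It will be
used both for Besov functions and for resolvents. -/
theorem reproducing {E : Type*} [NormedAddCommGroup E] [NormedSpace ℂ E] [CompleteSpace E]
    {h : ℂ → E} (hd : DifferentiableOn ℂ h halfPlane)
    (hb : ∀ a : ℝ, 0 < a → ∃ B : ℝ, ∀ z : ℂ, a ≤ z.re → ‖deriv h z‖ ≤ B) {L : E} {z : ℂ}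
    (hz : 0 < z.re) (hL : Tendsto (fun t : ℝ => h (t + z)) atTop (𝓝 L))
    (h0 : Tendsto (fun t : ℝ => (t : ℂ) • deriv h (t + z)) atTop (𝓝 0))
    (hint : Integrable (fun p : ℝ × ℝ => ((p.1 : ℂ) * ((p.1 - p.2 * Complex.I + z) ^ 2)⁻¹) •
      deriv h (p.1 + p.2 * Complex.I)) halfMeasure) :
    h z = L - (2 / Real.pi : ℂ) • ∫ p : ℝ × ℝ, ((p.1 : ℂ) *
      ((p.1 - p.2 * Complex.I + z) ^ 2)⁻¹) • deriv h (p.1 + p.2 * Complex.I) ∂halfMeasure := by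
  have hd' : DifferentiableOn ℂ (deriv h) halfPlane := hd.deriv isOpen_halfPlane
  rw [halfMeasure_eq] at hint ⊢
  have hinner : ∀ α : ℝ, α ∈ Ioi (0 : ℝ) → ∫ β : ℝ, ((α : ℂ) *
      ((α - β * Complex.I + z) ^ 2)⁻¹) • deriv h (α + β * Complex.I) =
      (-(Real.pi / 2) : ℂ) • ((4 * α : ℂ) • deriv (deriv h) (2 * α + z)) := by
    intro α hα
    have hα' : 0 < α := hα
    obtain ⟨B, hB⟩ := hb α hα
    have := integral_line_sq_inv_smul (ζ := 2 * α + z) hα (by simp; linarith) hd' hB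
    have he : ∀ β : ℝ, (2 * α + z - (α + β * Complex.I) : ℂ) = α - β * Complex.I + z :=
      fun β => by ring
    simp_rw [he] at this
    simp_rw [mul_smul]
    rw [integral_smul, this]
    simp only [smul_smul]
    congr 1
    ring
  have hf := hint.integral_prod_left
  rw [integral_prod _ hint, setIntegral_congr_fun measurableSet_Ioi hinner, integral_smul]
  have hf' : IntegrableOn (fun α : ℝ => (4 * α : ℂ) • deriv (deriv h) (2 * α + z)) (Ioi 0) := by
    have h1 : IntegrableOn (fun α : ℝ => (-(Real.pi / 2) : ℂ) •
        ((4 * α : ℂ) • deriv (deriv h) (2 * α + z))) (Ioi 0) :=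
      hf.congr ((ae_restrict_mem measurableSet_Ioi).mono hinner)
    have h2 := h1.smul ((-(Real.pi / 2) : ℂ)⁻¹)
    refine h2.congr (ae_of_all _ fun α => ?_)
    simp only [Pi.smul_apply]
    rw [smul_smul, inv_mul_cancel₀ (by simp), one_smul]
  -- `2α h'(2α + z) - h(2α + z)` is an antiderivative in `α` of the inner integral,
  -- up to the factor `-π/2`
  have hder : ∀ α ∈ Ici (0 : ℝ), HasDerivAt
      (fun α : ℝ => (2 * α : ℂ) • deriv h (2 * α + z) - h (2 * α + z))
      ((4 * α : ℂ) • deriv (deriv h) (2 * α + z)) α := by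
    intro α hα
    have hα' : 0 ≤ α := hα
    have hm : (2 * α + z : ℂ) ∈ halfPlane := by simp [halfPlane]; linarith
    have hlin : HasDerivAt (fun α : ℝ => (2 * α : ℂ)) 2 α := by
      simpa using (Complex.ofRealCLM.hasDerivAt (x := α)).const_mul (2 : ℂ)
    have d1 := ((hd _ hm).differentiableAt (isOpen_halfPlane.mem_nhds hm)).hasDerivAt
    have d2 := ((hd' _ hm).differentiableAt (isOpen_halfPlane.mem_nhds hm)).hasDerivAt
    have e1 := HasDerivAt.scomp α d1 (hlin.add_const z)
    have e2 := HasDerivAt.scomp α d2 (hlin.add_const z)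
    refine ((hlin.smul e2).sub e1).congr_deriv ?_
    simp only [Function.comp_apply]
    rw [smul_smul, add_sub_cancel_right]
    congr 1
    ring
  have h2 : Tendsto (fun α : ℝ => 2 * α) atTop atTop :=
    tendsto_id.const_mul_atTop (by norm_num)
  have hlim : Tendsto (fun α : ℝ => (2 * α : ℂ) • deriv h (2 * α + z) - h (2 * α + z)) atTop
      (𝓝 (0 - L)) := by
    have := (h0.comp h2).sub (hL.comp h2)
    simp only [Function.comp_def, Complex.ofReal_mul, Complex.ofReal_ofNat] at this
    rwa [zero_sub] at this ⊢
  rw [integral_Ioi_of_hasDerivAt_of_tendsto' hder hf' hlim, smul_smul]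
  have : (2 / Real.pi : ℂ) * (-(Real.pi / 2)) = -1 := by field_simp
  rw [this]
  simp

/-! ### Resolvent families on the half-plane -/

/-- An abstraction of `z ↦ (z + A)⁻¹` on the right half-plane, for `A` of constant `M`: a family
in a Banach algebra that satisfies the resolvent identity and `‖z R(z)‖ ≤ M`. -/
structure IsHalfPlaneResolvent {𝔸 : Type*} [NormedRing 𝔸] [NormedAlgebra ℂ 𝔸] (R : ℂ → 𝔸)
    (M : ℝ) : Prop where
  sub_eq : ∀ z w : ℂ, 0 < z.re → 0 < w.re → R z - R w = (w - z) • (R z * R w)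
  bound : ∀ z : ℂ, 0 < z.re → ‖z‖ * ‖R z‖ ≤ M

/-- The elementary estimate behind the factor `M (log M + 1)`: the three bounds are used on
`(0, α]`, `(α, Mα]` and `(Mα, ∞)`. -/
theorem lintegral_Ioi_le_of_three_bounds {φ : ℝ → ℝ≥0∞} {M α : ℝ} (hM : 1 ≤ M) (hα : 0 < α)
    (h1 : ∀ β, 0 < β → φ β ≤ ENNReal.ofReal (4 * M / α ^ 2))
    (h2 : ∀ β, 0 < β → φ β ≤ ENNReal.ofReal (4 * M / α * β⁻¹))
    (h3 : ∀ β, 0 < β → φ β ≤ ENNReal.ofReal (M ^ 2 * β ^ (-2 : ℝ))) :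
    ∫⁻ β in Ioi (0 : ℝ), φ β ≤ ENNReal.ofReal (5 * M * (Real.log M + 1) / α) := by
  have hM0 : 0 < M := by linarith
  have hMα : α ≤ M * α := le_mul_of_one_le_left hα.le hM
  have hlog := Real.log_nonneg hM
  have e1 : ∫⁻ β in Ioc 0 α, φ β ≤ ENNReal.ofReal (4 * M / α) := by
    refine (setLIntegral_mono' measurableSet_Ioc fun β hβ => h1 β hβ.1).trans ?_
    rw [setLIntegral_const, Real.volume_Ioc, ← ENNReal.ofReal_mul (by positivity)]
    refine ENNReal.ofReal_le_ofReal (le_of_eq ?_)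
    field_simp
    ring
  have e2 : ∫⁻ β in Ioc α (M * α), φ β ≤ ENNReal.ofReal (4 * M / α * Real.log M) := by
    refine (setLIntegral_mono' measurableSet_Ioc fun β hβ => h2 β (hα.trans hβ.1)).trans ?_
    have hi : IntegrableOn (fun β : ℝ => 4 * M / α * β⁻¹) (Ioc α (M * α)) := by
      rw [← intervalIntegrable_iff_integrableOn_Ioc_of_le hMα]
      refine (intervalIntegral.intervalIntegrable_inv (fun x hx => ?_) continuousOn_id).const_mul _
      rw [uIcc_of_le hMα] at hx
      exact (hα.trans_le hx.1).ne'
    rw [← ofReal_integral_eq_lintegral_ofReal hi, ← intervalIntegral.integral_of_le hMα,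
      intervalIntegral.integral_const_mul, integral_inv_of_pos hα (by positivity),
      mul_div_cancel_right₀ _ hα.ne']
    filter_upwards [ae_restrict_mem measurableSet_Ioc] with β hβ
    have : 0 < β := hα.trans hβ.1
    positivity
  have e3 : ∫⁻ β in Ioi (M * α), φ β ≤ ENNReal.ofReal (M / α) := by
    have hpos : 0 < M * α := by positivity
    refine (setLIntegral_mono' measurableSet_Ioi fun β hβ => h3 β (hpos.trans hβ)).trans ?_
    have hi := (integrableOn_Ioi_rpow_of_lt (a := -2) (by norm_num) hpos).const_mul (M ^ 2)
    rw [← ofReal_integral_eq_lintegral_ofReal hi, integral_const_mul,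
      integral_Ioi_rpow_of_lt (by norm_num) hpos]
    · refine ENNReal.ofReal_le_ofReal (le_of_eq ?_)
      have : (-2 + 1 : ℝ) = -1 := by norm_num
      rw [this, Real.rpow_neg_one]
      field_simp
    · filter_upwards [ae_restrict_mem measurableSet_Ioi] with β hβ
      have : 0 < β := hpos.trans hβ
      positivity
  have hsub : Ioi (0 : ℝ) ⊆ (Ioc 0 α ∪ Ioc α (M * α)) ∪ Ioi (M * α) := by
    rw [Ioc_union_Ioc_eq_Ioc hα.le hMα, Ioc_union_Ioi_eq_Ioi (by positivity)]
  calc ∫⁻ β in Ioi (0 : ℝ), φ β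
      ≤ ∫⁻ β in (Ioc 0 α ∪ Ioc α (M * α)) ∪ Ioi (M * α), φ β := lintegral_mono_set hsub
    _ ≤ (∫⁻ β in Ioc 0 α, φ β) + (∫⁻ β in Ioc α (M * α), φ β) +
          ∫⁻ β in Ioi (M * α), φ β :=
        (lintegral_union_le _ _ _).trans (add_le_add (lintegral_union_le _ _ _) le_rfl)
    _ ≤ _ := add_le_add (add_le_add e1 e2) e3
    _ = ENNReal.ofReal (4 * M / α + 4 * M / α * Real.log M + M / α) := by
        rw [← ENNReal.ofReal_add (by positivity) (by positivity),
          ← ENNReal.ofReal_add (by positivity) (by positivity)]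
    _ ≤ _ := by
        refine ENNReal.ofReal_le_ofReal ?_
        rw [div_mul_eq_mul_div, ← add_div, ← add_div]
        gcongr
        nlinarith [mul_nonneg hM0.le hlog]

namespace IsHalfPlaneResolvent

variable {𝔸 : Type*} [NormedRing 𝔸] [NormedAlgebra ℂ 𝔸] {R : ℂ → 𝔸} {M : ℝ}

theorem norm_le (hR : IsHalfPlaneResolvent R M) {z : ℂ} (hz : 0 < z.re) : ‖R z‖ ≤ M / ‖z‖ := by
  have hpos : 0 < ‖z‖ := hz.trans_le (Complex.re_le_norm z)
  rw [le_div_iff₀ hpos, mul_comm]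
  exact hR.bound z hz

theorem nonneg (hR : IsHalfPlaneResolvent R M) : 0 ≤ M :=
  le_trans (by positivity) (hR.bound 1 (by simp))

theorem norm_sq_le (hR : IsHalfPlaneResolvent R M) {z : ℂ} (hz : 0 < z.re) :
    ‖R z ^ 2‖ ≤ M ^ 2 / ‖z‖ ^ 2 := by
  rw [← div_pow, sq, sq]
  exact (norm_mul_le _ _).trans
    (mul_le_mul (hR.norm_le hz) (hR.norm_le hz) (norm_nonneg _)
      (div_nonneg hR.nonneg (norm_nonneg _)))

theorem commute (hR : IsHalfPlaneResolvent R M) {z w : ℂ} (hz : 0 < z.re) (hw : 0 < w.re) :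
    Commute (R z) (R w) := by
  rcases eq_or_ne z w with rfl | hne
  · exact Commute.refl _
  have h1 := hR.sub_eq z w hz hw
  have h2 := hR.sub_eq w z hw hz
  have h3 : (w - z) • (R z * R w) = (w - z) • (R w * R z) := by
    rw [← h1, ← neg_sub z w, neg_smul, ← h2, neg_sub]
  exact smul_right_injective _ (sub_ne_zero.2 hne.symm) h3

theorem continuousOn (hR : IsHalfPlaneResolvent R M) : ContinuousOn R halfPlane := by
  intro z hz
  have hz' : 0 < z.re := hz
  have hnz : ∀ w : ℂ, 0 < w.re → w ≠ 0 := by rintro w hw rfl; simp at hw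
  have hlim : Tendsto (fun w : ℂ => ‖z - w‖ * (M / ‖w‖ * (M / ‖z‖))) (𝓝[halfPlane] z) (𝓝 0) := by
    have : ContinuousAt (fun w : ℂ => ‖z - w‖ * (M / ‖w‖ * (M / ‖z‖))) z :=
      ContinuousAt.mul (by fun_prop) (ContinuousAt.mul (ContinuousAt.div₀ (by fun_prop)
        (by fun_prop) (norm_ne_zero_iff.2 (hnz z hz'))) (by fun_prop))
    simpa [ContinuousAt] using this.tendsto.mono_left nhdsWithin_le_nhds
  refine tendsto_iff_norm_sub_tendsto_zero.2 (squeeze_zero' (Eventually.of_forall fun _ =>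
    norm_nonneg _) ?_ hlim)
  filter_upwards [self_mem_nhdsWithin] with w hw
  have hw' : 0 < w.re := hw
  rw [hR.sub_eq w z hw' hz', norm_smul]
  gcongr
  exact (norm_mul_le _ _).trans (mul_le_mul (hR.norm_le hw') (hR.norm_le hz') (norm_nonneg _)
      (div_nonneg hR.nonneg (norm_nonneg _)))

theorem hasDerivAt (hR : IsHalfPlaneResolvent R M) {z : ℂ} (hz : 0 < z.re) :
    HasDerivAt R (-(R z ^ 2)) z := by
  rw [hasDerivAt_iff_tendsto_slope]
  have hc : ContinuousAt R z :=
    (hR.continuousOn z hz).continuousAt (isOpen_halfPlane.mem_nhds hz)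
  have h1 : Tendsto (fun w => -(R w * R z)) (𝓝[≠] z) (𝓝 (-(R z ^ 2))) := by
    rw [sq]
    exact ((hc.tendsto.mul_const (R z)).neg).mono_left nhdsWithin_le_nhds
  refine h1.congr' ?_
  filter_upwards [self_mem_nhdsWithin,
    mem_nhdsWithin_of_mem_nhds (isOpen_halfPlane.mem_nhds hz)] with w hne hw
  rw [slope_def_module, hR.sub_eq w z hw hz, smul_smul, ← neg_sub w z, mul_neg,
    inv_mul_cancel₀ (sub_ne_zero.2 hne), neg_smul, one_smul]

theorem differentiableOn (hR : IsHalfPlaneResolvent R M) : DifferentiableOn ℂ R halfPlane :=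
  fun _ hz => (hR.hasDerivAt hz).differentiableAt.differentiableWithinAt

/-- Cauchy's estimate on the disc of radius `Re z / 2` improves the trivial bound for `R(z)²`
near the imaginary axis: the power of `M` drops from two to one. -/
theorem norm_sq_le_of_cauchy (hR : IsHalfPlaneResolvent R M) {z : ℂ} (hz : 0 < z.re) :
    ‖R z ^ 2‖ ≤ 4 * M / (z.re * ‖z‖) := by
  have hpos : 0 < ‖z‖ := hz.trans_le (Complex.re_le_norm z)
  have hball : ∀ w : ℂ, ‖w - z‖ ≤ z.re / 2 → 0 < w.re := by
    intro w hw
    have := (Complex.abs_re_le_norm (w - z)).trans hw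
    rw [Complex.sub_re, abs_le] at this
    linarith
  have hcl : closure (Metric.ball z (z.re / 2)) ⊆ halfPlane := by
    intro w hw
    refine hball w ?_
    have := Metric.closure_ball_subset_closedBall hw
    rwa [Metric.mem_closedBall, dist_eq_norm] at this
  have h := Complex.norm_deriv_le_of_forall_mem_sphere_norm_le (c := z) (R := z.re / 2)
    (C := M / (‖z‖ / 2)) (f := R) (by linarith)
    ((hR.differentiableOn.mono hcl).diffContOnCl) (by
      intro w hw
      rw [Metric.mem_sphere, dist_eq_norm] at hw
      refine (hR.norm_le (hball w hw.le)).trans ?_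
      have h1 : ‖z‖ / 2 ≤ ‖w‖ := by
        have := norm_sub_norm_le z w
        rw [norm_sub_rev, hw] at this
        linarith [Complex.re_le_norm z]
      exact div_le_div_of_nonneg_left hR.nonneg (by positivity) h1)
  rw [(hR.hasDerivAt hz).deriv, norm_neg] at h
  refine h.trans (le_of_eq ?_)
  field_simp
  ring

theorem lintegral_norm_sq_le (hR : IsHalfPlaneResolvent R M) (hM : 1 ≤ M) {α : ℝ} (hα : 0 < α) :
    ∫⁻ β : ℝ, ‖R (α + β * Complex.I) ^ 2‖ₑ ≤
      ENNReal.ofReal (10 * M * (Real.log M + 1) / α) := by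
  have hre : ∀ β : ℝ, (α + β * Complex.I : ℂ).re = α := fun β => by simp
  have hnα : ∀ β : ℝ, α ≤ ‖(α + β * Complex.I : ℂ)‖ := fun β => by
    simpa [abs_of_pos hα] using Complex.abs_re_le_norm (α + β * Complex.I : ℂ)
  have hnβ : ∀ β : ℝ, |β| ≤ ‖(α + β * Complex.I : ℂ)‖ := fun β => by
    simpa using Complex.abs_im_le_norm (α + β * Complex.I : ℂ)
  have hcauchy : ∀ β : ℝ, ‖R (α + β * Complex.I) ^ 2‖ ≤
      4 * M / (α * ‖(α + β * Complex.I : ℂ)‖) := fun β => by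
    simpa [hre] using hR.norm_sq_le_of_cauchy (z := α + β * Complex.I) (by simpa using hα)
  have htriv : ∀ β : ℝ, ‖R (α + β * Complex.I) ^ 2‖ ≤
      M ^ 2 / ‖(α + β * Complex.I : ℂ)‖ ^ 2 := fun β =>
    hR.norm_sq_le (z := α + β * Complex.I) (by simpa using hα)
  have hM0 : 0 ≤ M := hR.nonneg
  have hlog := Real.log_nonneg hM
  have key : ∀ ε : ℝ, |ε| = 1 → ∫⁻ β in Ioi (0 : ℝ),
      ‖R (α + (ε * β : ℝ) * Complex.I) ^ 2‖ₑ ≤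
      ENNReal.ofReal (5 * M * (Real.log M + 1) / α) := by
    intro ε hε
    have habs : ∀ β : ℝ, 0 < β → |ε * β| = β := fun β hβ => by
      rw [abs_mul, hε, one_mul, abs_of_pos hβ]
    refine lintegral_Ioi_le_of_three_bounds hM hα (fun β hβ => ?_) (fun β hβ => ?_)
      (fun β hβ => ?_) <;> rw [← ofReal_norm] <;> refine ENNReal.ofReal_le_ofReal ?_
    · refine (hcauchy _).trans ?_
      rw [sq]
      gcongr
      exact hnα _
    · refine (hcauchy _).trans ?_
      rw [← div_eq_mul_inv, div_div]
      gcongr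
      exact (habs β hβ).symm.le.trans (hnβ _)
    · refine (htriv _).trans ?_
      rw [Real.rpow_neg hβ.le, ← div_eq_mul_inv, Real.rpow_two]
      gcongr
      exact (habs β hβ).symm.le.trans (hnβ _)
  have hneg : ∫⁻ β in Iic (0 : ℝ), ‖R (α + β * Complex.I) ^ 2‖ₑ =
      ∫⁻ β in Ioi (0 : ℝ), ‖R (α + ((-1) * β : ℝ) * Complex.I) ^ 2‖ₑ := by
    rw [setLIntegral_congr Iio_ae_eq_Iic.symm]
    have := (Measure.measurePreserving_neg (volume : Measure ℝ)).setLIntegral_comp_preimage_emb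
      (Homeomorph.neg ℝ).measurableEmbedding (fun β => ‖R (α + β * Complex.I) ^ 2‖ₑ) (Iio 0)
    rw [← this]
    simp
  have hsplit : ∫⁻ β : ℝ, ‖R (α + β * Complex.I) ^ 2‖ₑ =
      (∫⁻ β in Iic (0 : ℝ), ‖R (α + β * Complex.I) ^ 2‖ₑ) +
      ∫⁻ β in Ioi (0 : ℝ), ‖R (α + β * Complex.I) ^ 2‖ₑ := by
    rw [← lintegral_add_compl _ (measurableSet_Iic (a := (0 : ℝ))), compl_Iic]
  have k1 := key 1 (by simp)
  simp only [one_mul] at k1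
  rw [hsplit, hneg]
  refine (add_le_add (key (-1) (by simp)) k1).trans (le_of_eq ?_)
  rw [← ENNReal.ofReal_add (by positivity) (by positivity)]
  congr 1
  ring

end IsHalfPlaneResolvent

/-! ### Derivatives and values at infinity of Besov functions -/

/-- Cauchy's estimate on the disc of radius `Re z / 2`. -/
theorem norm_deriv_le_of_norm_sub_le {E : Type*} [NormedAddCommGroup E] [NormedSpace ℂ E]
    {g : ℂ → E} (hg : DifferentiableOn ℂ g halfPlane) {L : E} {C : ℝ} {z : ℂ} (hz : 0 < z.re)
    (hC : ∀ w : ℂ, z.re / 2 ≤ w.re → ‖g w - L‖ ≤ C) : ‖deriv g z‖ ≤ C / (z.re / 2) := by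
  have hball : ∀ w : ℂ, ‖w - z‖ ≤ z.re / 2 → z.re / 2 ≤ w.re := by
    intro w hw
    have := (Complex.abs_re_le_norm (w - z)).trans hw
    rw [Complex.sub_re, abs_le] at this
    linarith
  have hcl : closure (Metric.ball z (z.re / 2)) ⊆ halfPlane := by
    intro w hw
    have h1 := Metric.closure_ball_subset_closedBall hw
    rw [Metric.mem_closedBall, dist_eq_norm] at h1
    have := hball w h1
    exact lt_of_lt_of_le (by linarith) this
  rw [← deriv_sub_const L]
  refine Complex.norm_deriv_le_of_forall_mem_sphere_norm_le (by linarith)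
    (((hg.sub_const L).mono hcl).diffContOnCl) fun w hw => hC w (hball w ?_)
  rw [Metric.mem_sphere, dist_eq_norm] at hw
  exact hw.le

instance : reAtTop.NeBot := by
  rw [reAtTop, comap_neBot_iff]
  intro t ht
  obtain ⟨N, hN⟩ := mem_atTop_sets.1 ht
  refine ⟨⟨(max N 1 : ℝ), ?_⟩, ?_⟩
  · simp [halfPlane]
  · exact hN _ (by simp)

theorem valueAtInfty_eq {f : halfPlane → ℂ} {L : ℂ} (h : Tendsto f reAtTop (𝓝 L)) :
    valueAtInfty f = L :=
  h.limUnder_eq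

/-- `α ↦ sup_β |f'(α + iβ)|`. -/
noncomputable def supDeriv (f : halfPlane → ℂ) (α : ℝ) : ℝ≥0∞ := ⨆ β : ℝ, ‖derivAt f α β‖ₑ

theorem enorm_derivAt_le (f : halfPlane → ℂ) (α β : ℝ) : ‖derivAt f α β‖ₑ ≤ supDeriv f α :=
  le_iSup (fun β : ℝ => ‖derivAt f α β‖ₑ) β

theorem continuousOn_line_map : ContinuousOn (fun p : ℝ × ℝ => (p.1 + p.2 * Complex.I : ℂ))
    (Ioi 0 ×ˢ univ) := by fun_prop

theorem line_map_mem {p : ℝ × ℝ} (hp : p ∈ Ioi (0 : ℝ) ×ˢ (univ : Set ℝ)) :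
    (p.1 + p.2 * Complex.I : ℂ) ∈ halfPlane := mem_halfPlane hp.1 _

theorem conj_map_mem {p : ℝ × ℝ} (hp : p ∈ Ioi (0 : ℝ) ×ˢ (univ : Set ℝ)) :
    (p.1 - p.2 * Complex.I : ℂ) ∈ halfPlane := by
  have : 0 < p.1 := hp.1
  simpa [halfPlane] using this

theorem norm_conj_add_sq (p : ℝ × ℝ) (z : ℂ) :
    ‖(p.1 - p.2 * Complex.I + z : ℂ)‖ ^ 2 = (p.1 + z.re) ^ 2 + (p.2 - z.im) ^ 2 := by
  rw [Complex.sq_norm, Complex.normSq_apply]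
  simp
  ring

theorem le_norm_conj_add (p : ℝ × ℝ) (z : ℂ) :
    p.1 + z.re ≤ ‖(p.1 - p.2 * Complex.I + z : ℂ)‖ := by
  refine le_trans (le_of_eq ?_) (Complex.re_le_norm _)
  simp

theorem conj_add_ne_zero {p : ℝ × ℝ} (hp : 0 < p.1) {z : ℂ} (hz : 0 < z.re) :
    (p.1 - p.2 * Complex.I + z : ℂ) ≠ 0 :=
  norm_pos_iff.1 (lt_of_lt_of_le (by linarith) (le_norm_conj_add p z))

namespace IsBesov

variable {f g : halfPlane → ℂ}

theorem lintegral_supDeriv (hf : IsBesov f) : ∫⁻ α in Ioi (0 : ℝ), supDeriv f α < ⊤ := hf.2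

theorem aemeasurable_supDeriv (hf : IsBesov f) :
    AEMeasurable (supDeriv f) (volume.restrict (Ioi 0)) := aemeasurable_sup hf.1

theorem continuousOn_derivAt (hf : IsBesov f) :
    ContinuousOn (fun p : ℝ × ℝ => derivAt f p.1 p.2) (Ioi 0 ×ˢ univ) :=
  (continuousOn_deriv hf.1).comp continuousOn_line_map fun _ hp => line_map_mem hp

theorem exists_norm_le (hf : IsBesov f) :
    ∃ K : ℝ, 0 ≤ K ∧ ∀ z : ℂ, 0 < z.re → ‖extend f z‖ ≤ K := by
  obtain ⟨K, hK, h⟩ := exists_bound hf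
  refine ⟨K.toReal, ENNReal.toReal_nonneg, fun z hz => ?_⟩
  have := h ⟨z, hz⟩
  rw [← extend_coe f, ← ofReal_norm] at this
  exact (ENNReal.ofReal_le_iff_le_toReal hK).1 this

theorem exists_norm_sub_le (hf : IsBesov f) {ε : ℝ} (hε : 0 < ε) :
    ∃ N : ℝ, 0 < N ∧ ∀ z : ℂ, N ≤ z.re → ‖extend f z - valueAtInfty f‖ ≤ ε := by
  have h := (tendsto_valueAtInfty hf).eventually (Metric.closedBall_mem_nhds _ hε)
  rw [reAtTop, eventually_comap, eventually_atTop] at h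
  obtain ⟨N, hN⟩ := h
  refine ⟨max N 1, by simp, fun z hz => ?_⟩
  have hz0 : 0 < z.re := lt_of_lt_of_le (by simp) hz
  have := hN z.re ((le_max_left _ _).trans hz) ⟨z, hz0⟩ rfl
  rw [dist_eq_norm] at this
  rwa [← extend_coe f] at this

theorem exists_norm_deriv_le (hf : IsBesov f) {a : ℝ} (ha : 0 < a) :
    ∃ B : ℝ, ∀ z : ℂ, a ≤ z.re → ‖deriv (extend f) z‖ ≤ B := by
  obtain ⟨K, hK0, hK⟩ := hf.exists_norm_le
  refine ⟨K / (a / 2), fun z hz => ?_⟩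
  have h := norm_deriv_le_of_norm_sub_le hf.1 (L := 0) (C := K) (z := z) (by linarith)
    (fun w hw => by rw [sub_zero]; exact hK w (by linarith))
  refine h.trans ?_
  gcongr

/-- Finiteness holds for every `α > 0`, not only almost everywhere, by Cauchy's estimate. -/
theorem supDeriv_ne_top (hf : IsBesov f) {α : ℝ} (hα : 0 < α) : supDeriv f α ≠ ⊤ := by
  obtain ⟨B, hB⟩ := hf.exists_norm_deriv_le hα
  refine ne_top_of_le_ne_top (ENNReal.ofReal_ne_top (r := B)) (iSup_le fun β => ?_)
  rw [← ofReal_norm]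
  exact ENNReal.ofReal_le_ofReal (hB _ (by simp))

theorem tendsto_extend_add (hf : IsBesov f) (z : ℂ) :
    Tendsto (fun t : ℝ => extend f (t + z)) atTop (𝓝 (valueAtInfty f)) := by
  refine Metric.tendsto_atTop.2 fun ε hε => ?_
  obtain ⟨N, _, hN⟩ := hf.exists_norm_sub_le (half_pos hε)
  refine ⟨N - z.re, fun t ht => ?_⟩
  rw [dist_eq_norm]
  have := hN (t + z) (by simp; linarith)
  linarith

theorem tendsto_smul_deriv (hf : IsBesov f) {z : ℂ} (hz : 0 < z.re) :
    Tendsto (fun t : ℝ => (t : ℂ) • deriv (extend f) (t + z)) atTop (𝓝 0) := by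
  refine Metric.tendsto_atTop.2 fun ε hε => ?_
  obtain ⟨N, hN0, hN⟩ := hf.exists_norm_sub_le (ε := ε / 4) (by positivity)
  refine ⟨2 * N, fun t ht => ?_⟩
  have ht0 : 0 < t := by linarith
  have hre : (t + z : ℂ).re = t + z.re := by simp
  rw [dist_zero_right, norm_smul, Complex.norm_real, Real.norm_of_nonneg ht0.le]
  have h := norm_deriv_le_of_norm_sub_le hf.1 (L := valueAtInfty f) (C := ε / 4)
    (z := t + z) (by rw [hre]; linarith) (fun w hw => hN w (by rw [hre] at hw; linarith))
  rw [hre] at h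
  calc t * ‖deriv (extend f) (t + z)‖ ≤ t * (ε / 4 / ((t + z.re) / 2)) := by gcongr
    _ ≤ t * (ε / 4 / (t / 2)) := by gcongr; linarith
    _ = ε / 2 := by field_simp; norm_num
    _ < ε := by linarith

theorem integrable_reproducing (hf : IsBesov f) {z : ℂ} (hz : 0 < z.re) :
    Integrable (fun p : ℝ × ℝ => ((p.1 : ℂ) * ((p.1 - p.2 * Complex.I + z) ^ 2)⁻¹) *
      derivAt f p.1 p.2) halfMeasure := by
  refine integrable_half_of_le ?_ hf.aemeasurable_supDeriv hf.lintegral_supDeriv hz.le z.im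
    fun p hp => ?_
  · refine ContinuousOn.mul (ContinuousOn.mul (by fun_prop) (ContinuousOn.inv₀ (by fun_prop) ?_))
      hf.continuousOn_derivAt
    exact fun p hp => pow_ne_zero 2 (conj_add_ne_zero hp.1 hz)
  · rw [enorm_mul]
    refine mul_le_mul' (le_of_eq ?_) (enorm_derivAt_le f _ _)
    rw [← ofReal_norm, norm_mul, norm_inv, norm_pow, norm_conj_add_sq, Complex.norm_real,
      Real.norm_of_nonneg hp.le]

theorem reproducing (hf : IsBesov f) {z : ℂ} (hz : 0 < z.re) :
    extend f z = valueAtInfty f - (2 / Real.pi : ℂ) * ∫ p : ℝ × ℝ, ((p.1 : ℂ) *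
      ((p.1 - p.2 * Complex.I + z) ^ 2)⁻¹) * derivAt f p.1 p.2 ∂halfMeasure :=
  BesovCalculus.reproducing hf.1 (fun _ ha => hf.exists_norm_deriv_le ha) hz
    (hf.tendsto_extend_add z) (hf.tendsto_smul_deriv hz) (hf.integrable_reproducing hz)

/-- The reproducing formula of a Besov function may be differentiated under the integral. -/
theorem deriv_reproducing (hf : IsBesov f) {z : ℂ} (hz : 0 < z.re) :
    Integrable (fun p : ℝ × ℝ => ((p.1 : ℂ) * (-2 * ((p.1 - p.2 * Complex.I + z) ^ 3)⁻¹)) *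
      derivAt f p.1 p.2) halfMeasure ∧
    deriv (extend f) z = -(2 / Real.pi : ℂ) * ∫ p : ℝ × ℝ, ((p.1 : ℂ) *
      (-2 * ((p.1 - p.2 * Complex.I + z) ^ 3)⁻¹)) * derivAt f p.1 p.2 ∂halfMeasure := by
  have hre : ∀ w ∈ Metric.ball z (z.re / 2), 0 < w.re := by
    intro w hw
    rw [Metric.mem_ball, dist_eq_norm] at hw
    have := (Complex.abs_re_le_norm (w - z)).trans hw.le
    rw [Complex.sub_re, abs_le] at this
    linarith
  have hs : Metric.ball z (z.re / 2) ∈ 𝓝 z := Metric.ball_mem_nhds _ (by linarith)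
  have hcont : ContinuousOn (fun p : ℝ × ℝ => ((p.1 : ℂ) *
      (-2 * ((p.1 - p.2 * Complex.I + z) ^ 3)⁻¹)) * derivAt f p.1 p.2) (Ioi 0 ×ˢ univ) := by
    refine ContinuousOn.mul (ContinuousOn.mul (by fun_prop) (ContinuousOn.mul (by fun_prop)
      (ContinuousOn.inv₀ (by fun_prop) ?_))) hf.continuousOn_derivAt
    exact fun p hp => pow_ne_zero 3 (conj_add_ne_zero hp.1 hz)
  have key := hasDerivAt_integral_of_dominated_loc_of_deriv_le (μ := halfMeasure) (x₀ := z)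
    (F := fun (z : ℂ) (p : ℝ × ℝ) => ((p.1 : ℂ) * ((p.1 - p.2 * Complex.I + z) ^ 2)⁻¹) *
      derivAt f p.1 p.2)
    (F' := fun (z : ℂ) (p : ℝ × ℝ) => ((p.1 : ℂ) *
      (-2 * ((p.1 - p.2 * Complex.I + z) ^ 3)⁻¹)) * derivAt f p.1 p.2)
    (bound := fun p => 16 / z.re * ‖((p.1 : ℂ) * ((p.1 - p.2 * Complex.I + z) ^ 2)⁻¹) *
      derivAt f p.1 p.2‖) hs
    (by
      filter_upwards [hs] with w hw
      exact (hf.integrable_reproducing (hre w hw)).aestronglyMeasurable)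
    (hf.integrable_reproducing hz) (aestronglyMeasurable_half hcont)
    (by
      filter_upwards [ae_halfMeasure] with p hp w hw
      have h1 := le_norm_conj_add p z
      have h2 : ‖(p.1 - p.2 * Complex.I + z : ℂ)‖ / 2 ≤ ‖(p.1 - p.2 * Complex.I + w : ℂ)‖ := by
        rw [Metric.mem_ball, dist_comm, dist_eq_norm] at hw
        have := norm_sub_norm_le (p.1 - p.2 * Complex.I + z : ℂ) (p.1 - p.2 * Complex.I + w : ℂ)
        rw [add_sub_add_left_eq_sub] at this
        linarith
      have h3 : 0 < ‖(p.1 - p.2 * Complex.I + z : ℂ)‖ := by linarith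
      rw [norm_mul, norm_mul, norm_mul, norm_mul, norm_mul, norm_inv, norm_inv, norm_pow,
        norm_pow, norm_neg, ← mul_assoc (16 / z.re)]
      gcongr ?_ * _
      set n := ‖(p.1 - p.2 * Complex.I + z : ℂ)‖
      rw [mul_left_comm (16 / z.re)]
      gcongr _ * ?_
      calc ‖(2 : ℂ)‖ * (‖(p.1 - p.2 * Complex.I + w : ℂ)‖ ^ 3)⁻¹
          ≤ ‖(2 : ℂ)‖ * ((n / 2) ^ 3)⁻¹ := by gcongr
        _ = 16 / n * (n ^ 2)⁻¹ := by
            rw [show ‖(2 : ℂ)‖ = 2 by simp]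
            field_simp
            norm_num
        _ ≤ 16 / z.re * (n ^ 2)⁻¹ := by
            gcongr
            linarith)
    ((hf.integrable_reproducing hz).norm.const_mul _)
    (by
      filter_upwards [ae_halfMeasure] with p hp w hw
      have hne := conj_add_ne_zero hp (hre w hw)
      have d : HasDerivAt (fun z : ℂ => (p.1 - p.2 * Complex.I + z : ℂ)) 1 w := by
        simpa using (hasDerivAt_id w).const_add (p.1 - p.2 * Complex.I : ℂ)
      refine ((((d.pow 2).inv (pow_ne_zero 2 hne)).const_mul (p.1 : ℂ)).mul_const _).congr_deriv ?_
      congr 2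
      simp only [Pi.pow_apply]
      field_simp
      norm_num
      ring)
  refine ⟨key.1, ?_⟩
  have heq : extend f =ᶠ[𝓝 z] fun w => valueAtInfty f - (2 / Real.pi : ℂ) *
      ∫ p : ℝ × ℝ, ((p.1 : ℂ) * ((p.1 - p.2 * Complex.I + w) ^ 2)⁻¹) *
        derivAt f p.1 p.2 ∂halfMeasure := by
    filter_upwards [hs] with w hw using hf.reproducing (hre w hw)
  rw [heq.deriv_eq, ((key.2.const_mul _).const_sub _).deriv, neg_mul]

theorem derivAt_add (hf : IsBesov f) (hg : IsBesov g) {α : ℝ} (hα : 0 < α) (β : ℝ) :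
    derivAt (f + g) α β = derivAt f α β + derivAt g α β := by
  rw [derivAt_eq (f + g) (extend f + extend g) (fun z => by simp [extend_coe]) hα,
    ((hasDerivAt_extend hf hα β).add (hasDerivAt_extend hg hα β)).deriv]

theorem derivAt_mul (hf : IsBesov f) (hg : IsBesov g) {α : ℝ} (hα : 0 < α) (β : ℝ) :
    derivAt (f * g) α β = derivAt f α β * extend g (α + β * Complex.I) +
      extend f (α + β * Complex.I) * derivAt g α β := by
  rw [derivAt_eq (f * g) (extend f * extend g) (fun z => by simp [extend_coe]) hα,
    ((hasDerivAt_extend hf hα β).mul (hasDerivAt_extend hg hα β)).deriv]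

theorem smul (hf : IsBesov f) (c : ℂ) : IsBesov (c • f) :=
  isBesov_mul (isBesov_const c) hf

theorem derivAt_smul (hf : IsBesov f) (c : ℂ) {α : ℝ} (hα : 0 < α) (β : ℝ) :
    derivAt (c • f) α β = c * derivAt f α β := by
  rw [derivAt_eq (c • f) (fun z => c * extend f z) (fun z => by simp [extend_coe]) hα,
    ((hasDerivAt_extend hf hα β).const_mul c).deriv]

theorem valueAtInfty_add (hf : IsBesov f) (hg : IsBesov g) :
    valueAtInfty (f + g) = valueAtInfty f + valueAtInfty g :=
  valueAtInfty_eq ((tendsto_valueAtInfty hf).add (tendsto_valueAtInfty hg))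

theorem valueAtInfty_mul (hf : IsBesov f) (hg : IsBesov g) :
    valueAtInfty (f * g) = valueAtInfty f * valueAtInfty g :=
  valueAtInfty_eq ((tendsto_valueAtInfty hf).mul (tendsto_valueAtInfty hg))

theorem valueAtInfty_smul (hf : IsBesov f) (c : ℂ) :
    valueAtInfty (c • f) = c * valueAtInfty f :=
  valueAtInfty_eq ((tendsto_valueAtInfty hf).const_mul c)

theorem norm_valueAtInfty_le (hf : IsBesov f) :
    ‖valueAtInfty f‖ ≤ (⨆ z : halfPlane, ‖f z‖ₑ).toReal := by
  obtain ⟨K, hK, h⟩ := exists_bound hf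
  have htop : (⨆ z : halfPlane, ‖f z‖ₑ) ≠ ⊤ := ne_top_of_le_ne_top hK (iSup_le h)
  rw [← ENNReal.ofReal_le_iff_le_toReal htop, ofReal_norm]
  exact le_of_tendsto ((continuous_enorm.tendsto _).comp (tendsto_valueAtInfty hf))
    (Eventually.of_forall fun z => le_iSup (fun z : halfPlane => ‖f z‖ₑ) z)

end IsBesov

theorem valueAtInfty_const (c : ℂ) : valueAtInfty (fun _ => c) = c :=
  valueAtInfty_eq tendsto_const_nhds

theorem derivAt_const (c : ℂ) {α : ℝ} (hα : 0 < α) (β : ℝ) : derivAt (fun _ => c) α β = 0 := by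
  rw [derivAt_eq (fun _ => c) (fun _ => c) (fun _ => rfl) hα, deriv_const]

/-- The function `z ↦ (z + a)⁻¹` on the right half-plane. -/
noncomputable def shiftedInv (a : ℂ) : halfPlane → ℂ := fun z => ((z : ℂ) + a)⁻¹

theorem isBesov_shiftedInv {a : ℂ} (ha : 0 < a.re) : IsBesov (shiftedInv a) :=
  isBesov_resolventFun ⟨a, ha⟩

theorem extend_shiftedInv (a : ℂ) {z : ℂ} (hz : 0 < z.re) :
    extend (shiftedInv a) z = (z + a)⁻¹ :=
  extend_eqOn (shiftedInv a) (fun z => (z + a)⁻¹) (fun _ => rfl) hz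

theorem add_ne_zero_of_re_pos {z a : ℂ} (hz : 0 < z.re) (ha : 0 < a.re) : z + a ≠ 0 := by
  intro h
  have := congrArg Complex.re h
  simp at this
  linarith

theorem derivAt_shiftedInv {a : ℂ} (ha : 0 < a.re) {α : ℝ} (hα : 0 < α) (β : ℝ) :
    derivAt (shiftedInv a) α β = -((α + β * Complex.I + a) ^ 2)⁻¹ := by
  have hne := add_ne_zero_of_re_pos (mem_halfPlane hα β) ha
  have d : HasDerivAt (fun z : ℂ => (z + a)⁻¹) (-1 / (α + β * Complex.I + a) ^ 2)
      (α + β * Complex.I) := ((hasDerivAt_id _).add_const a).inv hne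
  rw [derivAt_eq (shiftedInv a) (fun z => (z + a)⁻¹) (fun _ => rfl) hα, d.deriv, neg_div, one_div]

theorem valueAtInfty_shiftedInv (a : ℂ) : valueAtInfty (shiftedInv a) = 0 := by
  refine valueAtInfty_eq ?_
  have h : Tendsto (fun z : halfPlane => ‖(z : ℂ) + a‖) reAtTop atTop := by
    refine tendsto_atTop_mono (fun z => Complex.re_le_norm _) ?_
    simp only [Complex.add_re]
    exact tendsto_atTop_add_const_right _ _ tendsto_comap
  rw [tendsto_zero_iff_norm_tendsto_zero]
  simp only [shiftedInv, norm_inv]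
  exact tendsto_inv_atTop_zero.comp h

/-! ### The calculus of a resolvent family -/

section Calculus

variable {𝔸 : Type*} [NormedRing 𝔸] [NormedAlgebra ℂ 𝔸] {R : ℂ → 𝔸} {M : ℝ}
  {f g : halfPlane → ℂ}

/-- The integrand `α f'(α + iβ) R(α - iβ)²`. -/
noncomputable def besovIntegrand (R : ℂ → 𝔸) (f : halfPlane → ℂ) (p : ℝ × ℝ) : 𝔸 :=
  (p.1 : ℂ) • (derivAt f p.1 p.2 • R (p.1 - p.2 * Complex.I) ^ 2)

/-- The value `f(∞) - (2/π) ∫ α f'(α + iβ) R(α - iβ)²` of the calculus. -/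
noncomputable def besovCalc (R : ℂ → 𝔸) (f : halfPlane → ℂ) : 𝔸 :=
  valueAtInfty f • (1 : 𝔸) - (2 / Real.pi : ℂ) • ∫ p, besovIntegrand R f p ∂halfMeasure

theorem continuousOn_conj_sq (hR : IsHalfPlaneResolvent R M) :
    ContinuousOn (fun p : ℝ × ℝ => R (p.1 - p.2 * Complex.I) ^ 2) (Ioi 0 ×ˢ univ) :=
  (hR.continuousOn.comp (by fun_prop) fun _ hp => conj_map_mem hp).pow 2

theorem norm_conj_sq (p : ℝ × ℝ) : ‖(p.1 - p.2 * Complex.I : ℂ)‖ ^ 2 = p.1 ^ 2 + p.2 ^ 2 := by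
  simpa using norm_conj_add_sq p 0

theorem norm_conj_resolvent_sq_le (hR : IsHalfPlaneResolvent R M) {p : ℝ × ℝ} (hp : 0 < p.1) :
    ‖R (p.1 - p.2 * Complex.I) ^ 2‖ ≤ M ^ 2 * (p.1 ^ 2 + p.2 ^ 2)⁻¹ := by
  rw [← norm_conj_sq, ← div_eq_mul_inv]
  exact hR.norm_sq_le (by simpa using hp)

theorem enorm_weighted_resolvent_sq_le (hR : IsHalfPlaneResolvent R M) {p : ℝ × ℝ}
    (hp : 0 < p.1) : ‖(p.1 : ℂ)‖ₑ * ‖R (p.1 - p.2 * Complex.I) ^ 2‖ₑ ≤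
      ENNReal.ofReal (p.1 * ((p.1 + 0) ^ 2 + (p.2 - 0) ^ 2)⁻¹) * ENNReal.ofReal (M ^ 2) := by
  rw [← ofReal_norm, ← ofReal_norm, ← ENNReal.ofReal_mul (by positivity),
    ← ENNReal.ofReal_mul (by positivity), Complex.norm_real, Real.norm_of_nonneg hp.le, add_zero,
    sub_zero]
  refine ENNReal.ofReal_le_ofReal ?_
  rw [mul_assoc, mul_comm _ (M ^ 2)]
  exact mul_le_mul_of_nonneg_left (norm_conj_resolvent_sq_le hR hp) hp.le

theorem continuousOn_besovIntegrand (hR : IsHalfPlaneResolvent R M) (hf : IsBesov f) :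
    ContinuousOn (besovIntegrand R f) (Ioi 0 ×ˢ univ) :=
  ContinuousOn.smul (by fun_prop) (hf.continuousOn_derivAt.smul (continuousOn_conj_sq hR))

theorem integrable_besovIntegrand (hR : IsHalfPlaneResolvent R M) (hf : IsBesov f) :
    Integrable (besovIntegrand R f) halfMeasure := by
  refine integrable_half_of_le (φ := fun α => ENNReal.ofReal (M ^ 2) * supDeriv f α)
    (continuousOn_besovIntegrand hR hf) (hf.aemeasurable_supDeriv.const_mul _) ?_ le_rfl 0
    fun p hp => ?_
  · rw [lintegral_const_mul' _ _ ENNReal.ofReal_ne_top]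
    exact ENNReal.mul_lt_top ENNReal.ofReal_lt_top hf.lintegral_supDeriv
  · rw [besovIntegrand, enorm_smul, enorm_smul, mul_left_comm, mul_comm, ← mul_assoc]
    exact mul_le_mul' (enorm_weighted_resolvent_sq_le hR hp) (enorm_derivAt_le f _ _)

theorem integrable_line (hR : IsHalfPlaneResolvent R M) (hf : IsBesov f) {α : ℝ} (hα : 0 < α) :
    Integrable (fun β : ℝ => derivAt f α β • R (α - β * Complex.I) ^ 2) := by
  obtain ⟨B, hB⟩ := hf.exists_norm_deriv_le hα
  have hmaps : ∀ β : ℝ, ((α, β) : ℝ × ℝ) ∈ Ioi (0 : ℝ) ×ˢ (univ : Set ℝ) := fun β =>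
    ⟨hα, mem_univ _⟩
  have hc : Continuous fun β : ℝ => derivAt f α β • R (α - β * Complex.I) ^ 2 :=
    (hf.continuousOn_derivAt.comp_continuous (Continuous.prodMk_right α) hmaps).smul
      ((continuousOn_conj_sq hR).comp_continuous (Continuous.prodMk_right α) hmaps)
  refine ((integrable_inv_sq_add_sq hα 0).const_mul (B * M ^ 2)).mono'
    hc.aestronglyMeasurable (ae_of_all _ fun β => ?_)
  rw [norm_smul, mul_assoc, sub_zero]
  have hB' : ‖derivAt f α β‖ ≤ B := hB _ (by simp)
  exact mul_le_mul hB' (norm_conj_resolvent_sq_le hR (p := (α, β)) hα) (norm_nonneg _)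
    ((norm_nonneg _).trans hB')

theorem besovCalc_add (hR : IsHalfPlaneResolvent R M) (hf : IsBesov f) (hg : IsBesov g) :
    besovCalc R (f + g) = besovCalc R f + besovCalc R g := by
  have h : ∫ p, besovIntegrand R (f + g) p ∂halfMeasure =
      ∫ p, besovIntegrand R f p ∂halfMeasure + ∫ p, besovIntegrand R g p ∂halfMeasure := by
    rw [← integral_add (integrable_besovIntegrand hR hf) (integrable_besovIntegrand hR hg)]
    refine integral_congr_ae ?_
    filter_upwards [ae_halfMeasure] with p hp
    simp only [besovIntegrand]
    rw [hf.derivAt_add hg hp, add_smul, smul_add]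
  rw [besovCalc, h, hf.valueAtInfty_add hg, besovCalc, besovCalc, add_smul, smul_add]
  abel

theorem besovCalc_smul (hf : IsBesov f) (c : ℂ) :
    besovCalc R (c • f) = c • besovCalc R f := by
  have h : ∫ p, besovIntegrand R (c • f) p ∂halfMeasure =
      c • ∫ p, besovIntegrand R f p ∂halfMeasure := by
    rw [← integral_smul]
    refine integral_congr_ae ?_
    filter_upwards [ae_halfMeasure] with p hp
    simp only [besovIntegrand]
    rw [hf.derivAt_smul c hp]
    simp only [smul_smul]
    congr 1
    ring
  rw [besovCalc, h, hf.valueAtInfty_smul c, besovCalc]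
  simp only [smul_sub, smul_smul]
  rw [mul_comm c (2 / Real.pi : ℂ)]

theorem besovCalc_const (c : ℂ) : besovCalc R (fun _ => c) = c • (1 : 𝔸) := by
  have h : ∫ p, besovIntegrand R (fun _ => c) p ∂halfMeasure = 0 := by
    refine integral_eq_zero_of_ae ?_
    filter_upwards [ae_halfMeasure] with p hp
    simp [besovIntegrand, derivAt_const c hp]
  rw [besovCalc, h, valueAtInfty_const, smul_zero, sub_zero]

/-- The conjugation `α + iβ ↦ α - iβ` preserves `halfMeasure`. -/
theorem integral_half_conj {E : Type*} [NormedAddCommGroup E] [NormedSpace ℝ E]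
    (G : ℝ × ℝ → E) :
    ∫ p, G (p.1, -p.2) ∂halfMeasure = ∫ p, G p ∂halfMeasure := by
  have h : MeasurePreserving (Prod.map id Neg.neg) halfMeasure halfMeasure := by
    rw [halfMeasure_eq]
    exact (MeasurePreserving.id _).prod (Measure.measurePreserving_neg volume)
  exact h.integral_comp
    ((Homeomorph.refl ℝ).prodCongr (Homeomorph.neg ℝ)).measurableEmbedding G

theorem integrable_decay_kernel {x : ℝ} (hx : 0 < x) :
    Integrable (fun p : ℝ × ℝ => p.1 * (p.1 ^ 2 + p.2 ^ 2)⁻¹ * ((p.1 + x) ^ 2)⁻¹)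
      halfMeasure := by
  have hint : IntegrableOn (fun α : ℝ => (α + x) ^ (-2 : ℝ)) (Ioi 0) :=
    integrableOn_add_rpow_Ioi_of_lt (by norm_num) (by linarith)
  refine integrable_half_of_le (φ := fun α => ‖(α + x) ^ (-2 : ℝ)‖ₑ) ?_ hint.1.enorm hint.2 le_rfl
    0 fun p hp => ?_
  · refine ContinuousOn.mul (ContinuousOn.mul (by fun_prop) (ContinuousOn.inv₀ (by fun_prop) ?_))
      (ContinuousOn.inv₀ (by fun_prop) ?_)
    · intro p hp
      have : 0 < p.1 := hp.1
      positivity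
    · intro p hp
      have : 0 < p.1 := hp.1
      positivity
  · have hpx : 0 < p.1 + x := by linarith
    rw [Real.rpow_neg hpx.le, Real.rpow_two, enorm_mul, add_zero, sub_zero,
      Real.enorm_of_nonneg (by positivity : (0 : ℝ) ≤ p.1 * (p.1 ^ 2 + p.2 ^ 2)⁻¹)]

/-- The reproducing formula applied to `R` itself, whose derivative is `-R²`. -/
theorem besovCalc_shiftedInv [CompleteSpace 𝔸] (hR : IsHalfPlaneResolvent R M) {a : ℂ}
    (ha : 0 < a.re) : besovCalc R (shiftedInv a) = R a := by
  have hderiv : ∀ z : ℂ, 0 < z.re → deriv R z = -(R z ^ 2) := fun z hz => (hR.hasDerivAt hz).deriv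
  have hM := hR.nonneg
  have hnorm : ∀ t : ℝ, t ≤ ‖(t + a : ℂ)‖ := fun t =>
    le_trans (by simp; linarith) (Complex.re_le_norm _)
  have hrep := BesovCalculus.reproducing (h := R) (L := 0) (z := a) hR.differentiableOn
    (by
      intro c hc
      refine ⟨M ^ 2 / c ^ 2, fun z hz => ?_⟩
      have hz0 : 0 < z.re := by linarith
      rw [hderiv z hz0, norm_neg]
      refine (hR.norm_sq_le hz0).trans ?_
      gcongr
      exact hz.trans (Complex.re_le_norm z)) ha
    (by
      have h1 : Tendsto (fun t : ℝ => M / t) atTop (𝓝 0) := tendsto_const_nhds.div_atTop tendsto_id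
      refine squeeze_zero_norm' ?_ h1
      filter_upwards [eventually_gt_atTop 0] with t ht
      refine (hR.norm_le (by simp; linarith)).trans ?_
      gcongr
      exact hnorm t)
    (by
      have h1 : Tendsto (fun t : ℝ => M ^ 2 / t) atTop (𝓝 0) :=
        tendsto_const_nhds.div_atTop tendsto_id
      refine squeeze_zero_norm' ?_ h1
      filter_upwards [eventually_gt_atTop 0] with t ht
      have hre : 0 < (t + a : ℂ).re := by simp; linarith
      rw [hderiv _ hre, norm_smul, norm_neg, Complex.norm_real, Real.norm_of_nonneg ht.le]
      calc t * ‖R (t + a) ^ 2‖ ≤ t * (M ^ 2 / ‖(t + a : ℂ)‖ ^ 2) := by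
            gcongr
            exact hR.norm_sq_le hre
        _ ≤ t * (M ^ 2 / t ^ 2) := by
            gcongr
            exact hnorm t
        _ = M ^ 2 / t := by field_simp)
    (by
      refine ((integrable_decay_kernel ha).const_mul (M ^ 2)).mono' (aestronglyMeasurable_half ?_)
        ?_
      · refine ContinuousOn.smul (ContinuousOn.mul (by fun_prop) (ContinuousOn.inv₀ (by fun_prop)
          ?_)) ((hR.differentiableOn.deriv isOpen_halfPlane).continuousOn.comp
            continuousOn_line_map fun _ hp => line_map_mem hp)
        exact fun p hp => pow_ne_zero 2 (conj_add_ne_zero hp.1 ha)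
      · filter_upwards [ae_halfMeasure] with p hp
        have hre : 0 < (p.1 + p.2 * Complex.I : ℂ).re := by simpa using hp
        have hsq := hR.norm_sq_le hre
        have he : ‖(p.1 + p.2 * Complex.I : ℂ)‖ ^ 2 = p.1 ^ 2 + p.2 ^ 2 := by
          simpa using norm_conj_sq (p.1, -p.2)
        rw [he, div_eq_mul_inv] at hsq
        have hle := le_norm_conj_add p a
        rw [hderiv _ hre, norm_smul, norm_neg, norm_mul, norm_inv, norm_pow, Complex.norm_real,
          Real.norm_of_nonneg hp.le]
        calc p.1 * (‖(p.1 - p.2 * Complex.I + a : ℂ)‖ ^ 2)⁻¹ *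
              ‖R (p.1 + p.2 * Complex.I) ^ 2‖
            ≤ p.1 * ((p.1 + a.re) ^ 2)⁻¹ * (M ^ 2 * (p.1 ^ 2 + p.2 ^ 2)⁻¹) := by gcongr
          _ = _ := by ring)
  rw [hrep, ← integral_half_conj, besovCalc, valueAtInfty_shiftedInv, zero_smul]
  congr 2
  refine integral_congr_ae ?_
  filter_upwards [ae_halfMeasure] with p hp
  simp only [besovIntegrand]
  rw [derivAt_shiftedInv ha hp, Complex.ofReal_neg, neg_mul, sub_neg_eq_add, ← sub_eq_add_neg,
    hderiv _ (by simpa using hp), smul_smul, mul_neg, neg_smul, smul_neg]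

theorem commute_besovCalc [CompleteSpace 𝔸] (hR : IsHalfPlaneResolvent R M) (hf : IsBesov f)
    {z : ℂ} (hz : 0 < z.re) : Commute (besovCalc R f) (R z) := by
  have hi := integrable_besovIntegrand hR hf
  have h : Commute (∫ p, besovIntegrand R f p ∂halfMeasure) (R z) := by
    rw [Commute, SemiconjBy, ← integral_mul_const_of_integrable hi,
      ← integral_const_mul_of_integrable hi]
    refine integral_congr_ae ?_
    filter_upwards [ae_halfMeasure] with p hp
    have hc : Commute (R (p.1 - p.2 * Complex.I)) (R z) := hR.commute (by simpa using hp) hz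
    exact ((hc.pow_left 2).smul_left _).smul_left _
  exact ((Commute.one_left _).smul_left _).sub_left (h.smul_left _)

theorem besovCalc_shiftedInv_mul [CompleteSpace 𝔸] (hR : IsHalfPlaneResolvent R M) {a b : ℂ}
    (ha : 0 < a.re) (hb : 0 < b.re) (hab : a ≠ b) :
    besovCalc R (shiftedInv a * shiftedInv b) = R a * R b := by
  have hne : b - a ≠ 0 := sub_ne_zero.2 hab.symm
  have h : shiftedInv a * shiftedInv b =
      (b - a)⁻¹ • (shiftedInv a + (-1 : ℂ) • shiftedInv b) := by
    funext z
    have h1 := add_ne_zero_of_re_pos z.2 ha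
    have h2 := add_ne_zero_of_re_pos z.2 hb
    simp only [shiftedInv, Pi.mul_apply, Pi.smul_apply, Pi.add_apply, smul_eq_mul]
    field_simp
    ring
  rw [h, besovCalc_smul (isBesov_add (isBesov_shiftedInv ha) ((isBesov_shiftedInv hb).smul _)),
    besovCalc_add hR (isBesov_shiftedInv ha) ((isBesov_shiftedInv hb).smul _),
    besovCalc_smul (isBesov_shiftedInv hb), besovCalc_shiftedInv hR ha, besovCalc_shiftedInv hR hb,
    neg_smul, one_smul, ← sub_eq_add_neg, hR.sub_eq a b ha hb, smul_smul, inv_mul_cancel₀ hne,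
    one_smul]

/-- The case `a = b` is the limit of `besovCalc_shiftedInv_mul` as `b → a`. -/
theorem besovCalc_shiftedInv_mul_self [CompleteSpace 𝔸] (hR : IsHalfPlaneResolvent R M) {a : ℂ}
    (ha : 0 < a.re) : besovCalc R (shiftedInv a * shiftedInv a) = R a ^ 2 := by
  have hre : ∀ t : ℝ, 0 ≤ t → a.re ≤ (a + t : ℂ).re ∧ 0 < (a + t : ℂ).re := fun t ht => by
    constructor <;> simp <;> linarith
  have hder : ∀ b : ℂ, 0 < b.re → ∀ p : ℝ × ℝ, 0 < p.1 →
      derivAt (shiftedInv a * shiftedInv b) p.1 p.2 =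
        -((p.1 + p.2 * Complex.I + a) ^ 2)⁻¹ * (p.1 + p.2 * Complex.I + b)⁻¹ +
        (p.1 + p.2 * Complex.I + a)⁻¹ * -((p.1 + p.2 * Complex.I + b) ^ 2)⁻¹ := by
    intro b hb p hp
    rw [(isBesov_shiftedInv ha).derivAt_mul (isBesov_shiftedInv hb) hp,
      derivAt_shiftedInv ha hp, derivAt_shiftedInv hb hp, extend_shiftedInv a (by simpa using hp),
      extend_shiftedInv b (by simpa using hp)]
  have hlim : Tendsto (fun t : ℝ => ∫ p, besovIntegrand R (shiftedInv a * shiftedInv (a + t)) p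
      ∂halfMeasure) (𝓝[>] 0) (𝓝 (∫ p, besovIntegrand R (shiftedInv a * shiftedInv a) p
        ∂halfMeasure)) := by
    refine tendsto_integral_filter_of_dominated_convergence
      (fun p => M ^ 2 * (2 * a.re⁻¹) *
        (p.1 * (p.1 ^ 2 + p.2 ^ 2)⁻¹ * ((p.1 + a.re) ^ 2)⁻¹)) ?_ ?_
      ((integrable_decay_kernel ha).const_mul _) ?_
    · filter_upwards [self_mem_nhdsWithin] with t ht
      have ht' : 0 < t := ht
      exact (integrable_besovIntegrand hR (isBesov_mul (isBesov_shiftedInv ha)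
        (isBesov_shiftedInv (hre t ht'.le).2))).aestronglyMeasurable
    · filter_upwards [self_mem_nhdsWithin] with t ht
      have ht' : 0 < t := ht
      filter_upwards [ae_halfMeasure] with p hp
      have hpa : 0 < p.1 + a.re := by linarith
      have hq : ∀ b : ℂ, a.re ≤ b.re → p.1 + a.re ≤ ‖(p.1 + p.2 * Complex.I + b : ℂ)‖ := by
        intro b hb
        refine le_trans ?_ (Complex.re_le_norm _)
        simpa using hb
      have h1 := hq a le_rfl
      have h2 := hq (a + t) (hre t ht'.le).1
      rw [besovIntegrand, norm_smul, norm_smul, hder _ (hre t ht'.le).2 p hp, Complex.norm_real,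
        Real.norm_of_nonneg hp.le]
      have hd : ‖-((p.1 + p.2 * Complex.I + a : ℂ) ^ 2)⁻¹ * (p.1 + p.2 * Complex.I + (a + t))⁻¹ +
          (p.1 + p.2 * Complex.I + a)⁻¹ * -((p.1 + p.2 * Complex.I + (a + t)) ^ 2)⁻¹‖ ≤
          2 * a.re⁻¹ * ((p.1 + a.re) ^ 2)⁻¹ := by
        refine (norm_add_le _ _).trans ?_
        rw [norm_mul, norm_mul, norm_neg, norm_neg, norm_inv, norm_inv, norm_inv, norm_inv,
          norm_pow, norm_pow]
        have i1 : ‖(p.1 + p.2 * Complex.I + a : ℂ)‖⁻¹ ≤ a.re⁻¹ := inv_anti₀ ha (by linarith)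
        have i2 : ‖(p.1 + p.2 * Complex.I + (a + t) : ℂ)‖⁻¹ ≤ a.re⁻¹ := inv_anti₀ ha (by linarith)
        have i3 : (‖(p.1 + p.2 * Complex.I + a : ℂ)‖ ^ 2)⁻¹ ≤ ((p.1 + a.re) ^ 2)⁻¹ := by gcongr
        have i4 : (‖(p.1 + p.2 * Complex.I + (a + t) : ℂ)‖ ^ 2)⁻¹ ≤ ((p.1 + a.re) ^ 2)⁻¹ := by
          gcongr
        calc _ ≤ ((p.1 + a.re) ^ 2)⁻¹ * a.re⁻¹ + a.re⁻¹ * ((p.1 + a.re) ^ 2)⁻¹ := by gcongr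
          _ = _ := by ring
      calc _ ≤ p.1 * ((2 * a.re⁻¹ * ((p.1 + a.re) ^ 2)⁻¹) * (M ^ 2 * (p.1 ^ 2 + p.2 ^ 2)⁻¹)) := by
            gcongr
            exact norm_conj_resolvent_sq_le hR hp
        _ = _ := by ring
    · filter_upwards [ae_halfMeasure] with p hp
      simp only [besovIntegrand]
      refine Tendsto.const_smul (Tendsto.smul_const ?_ _) _
      have hne : (p.1 + p.2 * Complex.I + (a + (0 : ℝ)) : ℂ) ≠ 0 := by
        simpa using add_ne_zero_of_re_pos (mem_halfPlane hp p.2) ha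
      have hc : ContinuousAt (fun t : ℝ =>
          -((p.1 + p.2 * Complex.I + a : ℂ) ^ 2)⁻¹ * (p.1 + p.2 * Complex.I + (a + t))⁻¹ +
          (p.1 + p.2 * Complex.I + a)⁻¹ * -((p.1 + p.2 * Complex.I + (a + t)) ^ 2)⁻¹) 0 :=
        ContinuousAt.add (ContinuousAt.mul (by fun_prop) (ContinuousAt.inv₀ (by fun_prop) hne))
          (ContinuousAt.mul (by fun_prop) (ContinuousAt.neg
            (ContinuousAt.inv₀ (by fun_prop) (pow_ne_zero 2 hne))))
      have := hc.tendsto.mono_left (nhdsWithin_le_nhds (s := Ioi 0))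
      rw [hder a ha p hp]
      rw [Complex.ofReal_zero, add_zero] at this
      refine this.congr' ?_
      filter_upwards [self_mem_nhdsWithin] with t ht
      have ht' : 0 < t := ht
      rw [hder _ (hre t ht'.le).2 p hp]
  have hRlim : Tendsto (fun t : ℝ => R a * R (a + t)) (𝓝[>] 0) (𝓝 (R a ^ 2)) := by
    have hc : ContinuousAt R (a + (0 : ℝ)) := by
      rw [Complex.ofReal_zero, add_zero]
      exact (hR.hasDerivAt ha).continuousAt
    have h1 : ContinuousAt (fun t : ℝ => R (a + t)) 0 :=
      ContinuousAt.comp (f := fun t : ℝ => (a + t : ℂ)) hc (by fun_prop)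
    have := (h1.tendsto.mono_left (nhdsWithin_le_nhds (s := Ioi 0))).const_mul (R a)
    rwa [Complex.ofReal_zero, add_zero, ← sq] at this
  have hzero : ∀ b : ℂ, 0 < b.re → valueAtInfty (shiftedInv a * shiftedInv b) = 0 := by
    intro b hb
    rw [(isBesov_shiftedInv ha).valueAtInfty_mul (isBesov_shiftedInv hb),
      valueAtInfty_shiftedInv, zero_mul]
  have hΦ : Tendsto (fun t : ℝ => besovCalc R (shiftedInv a * shiftedInv (a + t))) (𝓝[>] 0)
      (𝓝 (besovCalc R (shiftedInv a * shiftedInv a))) := by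
    rw [besovCalc, hzero a ha]
    refine ((hlim.const_smul (2 / Real.pi : ℂ)).const_sub ((0 : ℂ) • (1 : 𝔸))).congr' ?_
    filter_upwards [self_mem_nhdsWithin] with t ht
    have ht' : 0 < t := ht
    rw [besovCalc, hzero _ (hre t ht'.le).2]
  refine tendsto_nhds_unique hΦ (hRlim.congr' ?_)
  filter_upwards [self_mem_nhdsWithin] with t ht
  have ht' : 0 < t := ht
  rw [besovCalc_shiftedInv_mul hR ha (hre t ht'.le).2]
  simpa using ht'.ne'

end Calculus

/-! ### Multiplicativity and boundedness -/

section Multiplicativity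

variable {𝔸 : Type*} [NormedRing 𝔸] [NormedAlgebra ℂ 𝔸] {R : ℂ → 𝔸} {M : ℝ}
  {f g : halfPlane → ℂ}

theorem lintegral_Ioi_div_add_sq {a : ℝ} (ha : 0 < a) :
    ∫⁻ x in Ioi (0 : ℝ), ENNReal.ofReal (a / (a + x) ^ 2) = 1 := by
  have hder : ∀ x ∈ Ici (0 : ℝ), HasDerivAt (fun x : ℝ => -(a / (a + x))) (a / (a + x) ^ 2) x := by
    intro x hx
    have hx' : 0 ≤ x := hx
    have hne : a + x ≠ 0 := by positivity
    refine (((hasDerivAt_const x a).div ((hasDerivAt_id x).const_add a) hne).neg).congr_deriv ?_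
    simp only [id]
    field_simp
    ring
  have hpos : ∀ x ∈ Ioi (0 : ℝ), 0 ≤ a / (a + x) ^ 2 := fun x _ => by positivity
  have hlim : Tendsto (fun x : ℝ => -(a / (a + x))) atTop (𝓝 0) := by
    simpa using (tendsto_const_nhds.div_atTop
      (tendsto_atTop_add_const_left atTop a tendsto_id)).neg
  rw [← ofReal_integral_eq_lintegral_ofReal (integrableOn_Ioi_deriv_of_nonneg' hder hpos hlim)
    ((ae_restrict_mem measurableSet_Ioi).mono hpos),
    integral_Ioi_of_hasDerivAt_of_nonneg' hder hpos hlim]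
  simp [ha.ne']

/-- The integrand `(v, w) ↦ α_v α_w f'(w) (k_w g)'(v) R(v̄)²`, where `k_w(z) = (z + w̄)⁻²`, whose
two iterated integrals are compared in the proof of multiplicativity. -/
noncomputable def doubleIntegrand (R : ℂ → 𝔸) (f g : halfPlane → ℂ) (q : (ℝ × ℝ) × (ℝ × ℝ)) : 𝔸 :=
  ((q.2.1 : ℂ) * derivAt f q.2.1 q.2.2 *
    (-2 * ((q.2.1 - q.2.2 * Complex.I + (q.1.1 + q.1.2 * Complex.I)) ^ 3)⁻¹ *
        extend g (q.1.1 + q.1.2 * Complex.I) +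
      ((q.2.1 - q.2.2 * Complex.I + (q.1.1 + q.1.2 * Complex.I)) ^ 2)⁻¹ *
        derivAt g q.1.1 q.1.2)) •
    ((q.1.1 : ℂ) • R (q.1.1 - q.1.2 * Complex.I) ^ 2)

/-- The scalar factor `(k_w g)'(v)` in `doubleIntegrand`. -/
theorem derivAt_kernel_mul (hg : IsBesov g) {v w : ℝ × ℝ} (hv : 0 < v.1) (hw : 0 < w.1) :
    derivAt (shiftedInv (w.1 - w.2 * Complex.I) * shiftedInv (w.1 - w.2 * Complex.I) * g) v.1 v.2 =
      -2 * ((w.1 - w.2 * Complex.I + (v.1 + v.2 * Complex.I)) ^ 3)⁻¹ *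
        extend g (v.1 + v.2 * Complex.I) +
      ((w.1 - w.2 * Complex.I + (v.1 + v.2 * Complex.I)) ^ 2)⁻¹ * derivAt g v.1 v.2 := by
  have ha : 0 < (w.1 - w.2 * Complex.I : ℂ).re := by simpa using hw
  have hb := isBesov_shiftedInv ha
  have hvm : 0 < (v.1 + v.2 * Complex.I : ℂ).re := by simpa using hv
  have hne := add_ne_zero_of_re_pos hvm ha
  have hex : extend (shiftedInv (w.1 - w.2 * Complex.I) * shiftedInv (w.1 - w.2 * Complex.I))
      (v.1 + v.2 * Complex.I) = ((v.1 + v.2 * Complex.I + (w.1 - w.2 * Complex.I)) ^ 2)⁻¹ := by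
    rw [extend_eqOn (shiftedInv (w.1 - w.2 * Complex.I) * shiftedInv (w.1 - w.2 * Complex.I))
      (fun z => ((z + (w.1 - w.2 * Complex.I)) ^ 2)⁻¹)
      (fun z => by simp [shiftedInv, sq]) hvm]
  rw [(isBesov_mul hb hb).derivAt_mul hg hv, hb.derivAt_mul hb hv, derivAt_shiftedInv ha hv,
    extend_shiftedInv _ hvm, hex,
    add_comm (w.1 - w.2 * Complex.I : ℂ) (v.1 + v.2 * Complex.I)]
  field_simp
  ring

theorem continuousOn_doubleIntegrand (hR : IsHalfPlaneResolvent R M) (hf : IsBesov f)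
    (hg : IsBesov g) : ContinuousOn (doubleIntegrand R f g)
      ((Ioi (0 : ℝ) ×ˢ (univ : Set ℝ)) ×ˢ (Ioi (0 : ℝ) ×ˢ (univ : Set ℝ))) := by
  have h1 : MapsTo (Prod.fst : (ℝ × ℝ) × (ℝ × ℝ) → ℝ × ℝ)
      ((Ioi (0 : ℝ) ×ˢ (univ : Set ℝ)) ×ˢ (Ioi (0 : ℝ) ×ˢ (univ : Set ℝ)))
      (Ioi (0 : ℝ) ×ˢ (univ : Set ℝ)) := fun _ h => h.1
  have h2 : MapsTo (Prod.snd : (ℝ × ℝ) × (ℝ × ℝ) → ℝ × ℝ)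
      ((Ioi (0 : ℝ) ×ˢ (univ : Set ℝ)) ×ˢ (Ioi (0 : ℝ) ×ˢ (univ : Set ℝ)))
      (Ioi (0 : ℝ) ×ˢ (univ : Set ℝ)) := fun _ h => h.2
  have hext : ContinuousOn (fun p : ℝ × ℝ => extend g (p.1 + p.2 * Complex.I))
      (Ioi 0 ×ˢ univ) :=
    hg.1.continuousOn.comp continuousOn_line_map fun _ hp => line_map_mem hp
  have hne : ∀ q ∈ ((Ioi (0 : ℝ) ×ˢ (univ : Set ℝ)) ×ˢ (Ioi (0 : ℝ) ×ˢ (univ : Set ℝ))),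
      (q.2.1 - q.2.2 * Complex.I + (q.1.1 + q.1.2 * Complex.I) : ℂ) ≠ 0 := fun q hq =>
    conj_add_ne_zero hq.2.1 (line_map_mem hq.1)
  have c1 := hf.continuousOn_derivAt.comp continuousOn_snd h2
  have c2 := hg.continuousOn_derivAt.comp continuousOn_fst h1
  have c3 := hext.comp continuousOn_fst h1
  have c4 := (continuousOn_conj_sq hR).comp continuousOn_fst h1
  refine ContinuousOn.smul (ContinuousOn.mul (ContinuousOn.mul (by fun_prop) c1)
    (ContinuousOn.add (ContinuousOn.mul (ContinuousOn.mul (by fun_prop)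
      (ContinuousOn.inv₀ (by fun_prop) fun q hq => pow_ne_zero 3 (hne q hq))) c3)
      (ContinuousOn.mul (ContinuousOn.inv₀ (by fun_prop) fun q hq => pow_ne_zero 2 (hne q hq)) c2)))
    (ContinuousOn.smul (by fun_prop) c4)

/-- Although `∫ α f'(w) ‖k_w‖ dw` diverges in the Besov norm, the double integral converges
absolutely: integrating first in the imaginary parts leaves an integrable function of the real
parts. -/
theorem integrable_doubleIntegrand (hR : IsHalfPlaneResolvent R M) (hf : IsBesov f)
    (hg : IsBesov g) : Integrable (doubleIntegrand R f g) (halfMeasure.prod halfMeasure) := by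
  obtain ⟨K, hK0, hK⟩ := hg.exists_norm_le
  have hsf := hf.aemeasurable_supDeriv
  have hsg := hg.aemeasurable_supDeriv
  constructor
  · rw [halfMeasure, Measure.prod_restrict]
    exact (continuousOn_doubleIntegrand hR hf hg).aestronglyMeasurable
      (measurableSet_half.prod measurableSet_half)
  -- the bound that remains after integration in the imaginary part of `w`
  set B : ℝ → ℝ → ℝ≥0∞ := fun x α => supDeriv f α *
    (ENNReal.ofReal (2 * K) * ENNReal.ofReal (α / (α + x) ^ 2) + supDeriv g x) with hB
  have hBm : AEMeasurable (Function.uncurry B)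
      ((volume.restrict (Ioi (0 : ℝ))).prod (volume.restrict (Ioi (0 : ℝ)))) :=
    AEMeasurable.mul hsf.comp_snd (AEMeasurable.add (by fun_prop) hsg.comp_fst)
  have hpt : ∀ v : ℝ × ℝ, 0 < v.1 → ∀ w : ℝ × ℝ, 0 < w.1 → ‖doubleIntegrand R f g (v, w)‖ₑ ≤
      ENNReal.ofReal (v.1 * ((v.1 + 0) ^ 2 + (v.2 - 0) ^ 2)⁻¹) * ENNReal.ofReal (M ^ 2) *
      (ENNReal.ofReal (w.1 * ((w.1 + v.1) ^ 2 + (w.2 - v.2) ^ 2)⁻¹) *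
        (supDeriv f w.1 * (ENNReal.ofReal (2 * K / (w.1 + v.1)) + supDeriv g v.1))) := by
    intro v hv w hw
    have hvm : 0 < (v.1 + v.2 * Complex.I : ℂ).re := by simpa using hv
    have hle := le_norm_conj_add w (v.1 + v.2 * Complex.I)
    have hsq := norm_conj_add_sq w (v.1 + v.2 * Complex.I)
    simp only [Complex.add_re, Complex.ofReal_re, Complex.mul_re, Complex.I_re, mul_zero,
      Complex.ofReal_im, Complex.I_im, mul_one, sub_self, add_zero, Complex.add_im,
      Complex.mul_im, zero_add] at hle hsq
    have hs0 : 0 < w.1 + v.1 := by linarith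
    set n : ℝ := ‖(w.1 - w.2 * Complex.I + (v.1 + v.2 * Complex.I) : ℂ)‖ with hn
    have hn0 : 0 < n := by linarith
    have e1 : ‖-2 * ((w.1 - w.2 * Complex.I + (v.1 + v.2 * Complex.I) : ℂ) ^ 3)⁻¹ *
        extend g (v.1 + v.2 * Complex.I)‖ₑ ≤
        ENNReal.ofReal ((n ^ 2)⁻¹) * ENNReal.ofReal (2 * K / (w.1 + v.1)) := by
      rw [← ofReal_norm, ← ENNReal.ofReal_mul (by positivity)]
      refine ENNReal.ofReal_le_ofReal ?_
      rw [norm_mul, norm_mul, norm_neg, norm_inv, norm_pow, ← hn]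
      calc ‖(2 : ℂ)‖ * (n ^ 3)⁻¹ * ‖extend g (v.1 + v.2 * Complex.I)‖
          ≤ ‖(2 : ℂ)‖ * (n ^ 3)⁻¹ * K := by
            gcongr
            exact hK _ hvm
        _ = (n ^ 2)⁻¹ * (2 * K / n) := by
            rw [show ‖(2 : ℂ)‖ = 2 by simp]
            field_simp
        _ ≤ _ := by gcongr
    have e2 : ‖((w.1 - w.2 * Complex.I + (v.1 + v.2 * Complex.I) : ℂ) ^ 2)⁻¹ *
        derivAt g v.1 v.2‖ₑ ≤ ENNReal.ofReal ((n ^ 2)⁻¹) * supDeriv g v.1 := by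
      rw [enorm_mul, ← ofReal_norm (((w.1 - w.2 * Complex.I + (v.1 + v.2 * Complex.I) : ℂ) ^ 2)⁻¹),
        norm_inv, norm_pow]
      exact mul_le_mul' le_rfl (enorm_derivAt_le g _ _)
    rw [doubleIntegrand, enorm_smul, enorm_smul, mul_comm]
    refine mul_le_mul' (enorm_weighted_resolvent_sq_le hR hv) ?_
    rw [enorm_mul, enorm_mul, ← ofReal_norm (w.1 : ℂ), Complex.norm_real, Real.norm_of_nonneg hw.le,
      ← hsq, ENNReal.ofReal_mul hw.le]
    simp only [mul_assoc (ENNReal.ofReal w.1)]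
    refine mul_le_mul' le_rfl ?_
    rw [mul_left_comm (ENNReal.ofReal _)]
    refine mul_le_mul' (enorm_derivAt_le f _ _) ?_
    rw [mul_add]
    exact (enorm_add_le _ _).trans (add_le_add e1 e2)
  have hinner : ∀ v : ℝ × ℝ, 0 < v.1 → ∫⁻ w, ‖doubleIntegrand R f g (v, w)‖ₑ ∂halfMeasure ≤
      ENNReal.ofReal (v.1 * ((v.1 + 0) ^ 2 + (v.2 - 0) ^ 2)⁻¹) * (ENNReal.ofReal (M ^ 2) *
        (ENNReal.ofReal Real.pi * ∫⁻ α in Ioi (0 : ℝ), B v.1 α)) := by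
    intro v hv
    refine (lintegral_mono_ae (ae_halfMeasure.mono fun w hw => hpt v hv w hw)).trans ?_
    rw [lintegral_const_mul' _ _ (ENNReal.mul_ne_top ENNReal.ofReal_ne_top ENNReal.ofReal_ne_top),
      mul_assoc]
    have hφ : AEMeasurable (fun α => supDeriv f α *
        (ENNReal.ofReal (2 * K / (α + v.1)) + supDeriv g v.1)) (volume.restrict (Ioi 0)) :=
      AEMeasurable.mul hsf (by fun_prop)
    rw [lintegral_half_kernel hφ hv.le v.2]
    refine mul_le_mul' le_rfl (mul_le_mul' le_rfl (mul_le_mul' le_rfl ?_))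
    refine setLIntegral_mono' measurableSet_Ioi fun α hα => ?_
    have hα' : 0 < α := hα
    have hs0 : 0 < α + v.1 := by linarith
    rw [hB, mul_left_comm]
    refine mul_le_mul' le_rfl ?_
    rw [mul_add]
    refine add_le_add (le_of_eq ?_) ?_
    · rw [← ENNReal.ofReal_mul (by positivity), ← ENNReal.ofReal_mul (by positivity)]
      congr 1
      field_simp
    · refine (mul_le_mul' (ENNReal.ofReal_le_one.2 ?_) le_rfl).trans_eq (one_mul _)
      exact div_le_one_of_le₀ (by linarith) (by linarith)
  have hBint : ∫⁻ x in Ioi (0 : ℝ), ∫⁻ α in Ioi (0 : ℝ), B x α < ⊤ := by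
    rw [lintegral_lintegral_swap hBm]
    have : ∀ α ∈ Ioi (0 : ℝ), ∫⁻ x in Ioi (0 : ℝ), B x α = supDeriv f α *
        (ENNReal.ofReal (2 * K) + ∫⁻ x in Ioi (0 : ℝ), supDeriv g x) := by
      intro α hα
      have hm : AEMeasurable (fun x => ENNReal.ofReal (2 * K) * ENNReal.ofReal (α / (α + x) ^ 2) +
          supDeriv g x) (volume.restrict (Ioi 0)) := AEMeasurable.add (by fun_prop) hsg
      simp only [hB]
      rw [lintegral_const_mul'' _ hm,
        lintegral_add_right' _ hsg, lintegral_const_mul _ (by fun_prop),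
        lintegral_Ioi_div_add_sq hα, mul_one]
    rw [setLIntegral_congr_fun measurableSet_Ioi this, lintegral_mul_const'' _ hsf]
    exact ENNReal.mul_lt_top hf.lintegral_supDeriv
      (ENNReal.add_lt_top.2 ⟨ENNReal.ofReal_lt_top, hg.lintegral_supDeriv⟩)
  have hBm' : AEMeasurable (fun x => ∫⁻ α in Ioi (0 : ℝ), B x α) (volume.restrict (Ioi 0)) :=
    hBm.lintegral_prod_right
  refine lt_of_le_of_lt ((lintegral_prod_le _).trans
    ((lintegral_mono_ae (ae_halfMeasure.mono hinner)).trans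
      (lintegral_half_kernel_le ((hBm'.const_mul _).const_mul _) le_rfl 0))) ?_
  rw [lintegral_const_mul' _ _ ENNReal.ofReal_ne_top,
    lintegral_const_mul' _ _ ENNReal.ofReal_ne_top]
  exact ENNReal.mul_lt_top ENNReal.ofReal_lt_top (ENNReal.mul_lt_top ENNReal.ofReal_lt_top
    (ENNReal.mul_lt_top ENNReal.ofReal_lt_top hBint))

theorem lintegral_enorm_besovIntegrand_le {K : ℝ} (hf : IsBesov f)
    (hK : ∀ α : ℝ, 0 < α →
      ∫⁻ β : ℝ, ‖R (α + β * Complex.I) ^ 2‖ₑ ≤ ENNReal.ofReal (K / α)) :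
    ∫⁻ p, ‖besovIntegrand R f p‖ₑ ∂halfMeasure ≤ ENNReal.ofReal K * besovSeminorm f := by
  have hconj : ∀ α : ℝ, ∫⁻ β : ℝ, ‖R (α - β * Complex.I) ^ 2‖ₑ =
      ∫⁻ β : ℝ, ‖R (α + β * Complex.I) ^ 2‖ₑ := by
    intro α
    rw [← (Measure.measurePreserving_neg (volume : Measure ℝ)).lintegral_comp_emb
      (Homeomorph.neg ℝ).measurableEmbedding]
    simp [sub_eq_add_neg]
  rw [halfMeasure_eq]
  refine (lintegral_prod_le _).trans ?_
  rw [besovSeminorm, ← lintegral_const_mul' _ _ ENNReal.ofReal_ne_top]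
  refine setLIntegral_mono' measurableSet_Ioi fun α hα => ?_
  have hα' : 0 < α := hα
  have htop := hf.supDeriv_ne_top hα'
  calc ∫⁻ β : ℝ, ‖besovIntegrand R f (α, β)‖ₑ
      ≤ ∫⁻ β : ℝ, (ENNReal.ofReal α * supDeriv f α) * ‖R (α - β * Complex.I) ^ 2‖ₑ := by
        refine lintegral_mono fun β => ?_
        rw [besovIntegrand, enorm_smul, enorm_smul, ← mul_assoc, ← ofReal_norm (α : ℂ),
          Complex.norm_real, Real.norm_of_nonneg hα'.le]
        exact mul_le_mul' (mul_le_mul' le_rfl (enorm_derivAt_le f _ _)) le_rfl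
    _ = (ENNReal.ofReal α * supDeriv f α) * ∫⁻ β : ℝ, ‖R (α - β * Complex.I) ^ 2‖ₑ :=
        lintegral_const_mul' _ _ (ENNReal.mul_ne_top ENNReal.ofReal_ne_top htop)
    _ ≤ (ENNReal.ofReal α * supDeriv f α) * ENNReal.ofReal (K / α) := by
        rw [hconj]
        exact mul_le_mul' le_rfl (hK α hα')
    _ = ENNReal.ofReal K * supDeriv f α := by
        rw [mul_comm, ← mul_assoc, ← ENNReal.ofReal_mul' hα'.le, div_mul_cancel₀ _ hα'.ne']

variable [CompleteSpace 𝔸]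

/-- Multiplicativity for products with `g` only needs to be checked for the kernels
`k_w(z) = (z + w̄)⁻²` of the reproducing formula: write `f` through that formula inside the integral
that defines the calculus at `f * g`, and exchange the two integrals. -/
theorem besovCalc_mul_of_kernel (hR : IsHalfPlaneResolvent R M) (hf : IsBesov f) (hg : IsBesov g)
    (hk : ∀ᵐ w : ℝ × ℝ ∂halfMeasure, besovCalc R
      (shiftedInv (w.1 - w.2 * Complex.I) * shiftedInv (w.1 - w.2 * Complex.I) * g) =
        besovCalc R g * R (w.1 - w.2 * Complex.I) ^ 2) :
    besovCalc R (f * g) = besovCalc R g * besovCalc R f := by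
  have hfg := isBesov_mul hf hg
  have hif := integrable_besovIntegrand hR hf
  have hig := integrable_besovIntegrand hR hg
  have hifg := integrable_besovIntegrand hR hfg
  have hswap := integral_integral_swap (f := fun v w => doubleIntegrand R f g (v, w))
    (integrable_doubleIntegrand hR hf hg)
  -- the inner integral in `w` is evaluated by the reproducing formulas for `f` and `f'`
  have hleft : ∫ v, ∫ w, doubleIntegrand R f g (v, w) ∂halfMeasure ∂halfMeasure =
      (-(Real.pi / 2) : ℂ) • (∫ p, besovIntegrand R (f * g) p ∂halfMeasure -
        valueAtInfty f • ∫ p, besovIntegrand R g p ∂halfMeasure) := by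
    have hig' : Integrable (fun p => valueAtInfty f • besovIntegrand R g p) halfMeasure :=
      Integrable.smul (valueAtInfty f) hig
    rw [← integral_smul, ← integral_sub hifg hig', ← integral_smul]
    refine integral_congr_ae ?_
    filter_upwards [ae_halfMeasure] with v hv
    have hvm : 0 < (v.1 + v.2 * Complex.I : ℂ).re := by simpa using hv
    have i1 := hf.deriv_reproducing hvm
    have i2 := hf.integrable_reproducing hvm
    have r2 := hf.reproducing hvm
    simp only [doubleIntegrand]
    have hscal : ∀ w : ℝ × ℝ, (w.1 : ℂ) * derivAt f w.1 w.2 *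
        (-2 * ((w.1 - w.2 * Complex.I + (v.1 + v.2 * Complex.I)) ^ 3)⁻¹ *
          extend g (v.1 + v.2 * Complex.I) +
        ((w.1 - w.2 * Complex.I + (v.1 + v.2 * Complex.I)) ^ 2)⁻¹ * derivAt g v.1 v.2) =
        ((w.1 : ℂ) * (-2 * ((w.1 - w.2 * Complex.I + (v.1 + v.2 * Complex.I)) ^ 3)⁻¹)) *
          derivAt f w.1 w.2 * extend g (v.1 + v.2 * Complex.I) +
        ((w.1 : ℂ) * ((w.1 - w.2 * Complex.I + (v.1 + v.2 * Complex.I)) ^ 2)⁻¹) *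
          derivAt f w.1 w.2 * derivAt g v.1 v.2 := fun w => by ring
    simp_rw [hscal]
    rw [integral_smul_const, integral_add (i1.1.mul_const _) (i2.mul_const _), integral_mul_const,
      integral_mul_const]
    have j1 : ∫ w : ℝ × ℝ, ((w.1 : ℂ) *
        (-2 * ((w.1 - w.2 * Complex.I + (v.1 + v.2 * Complex.I)) ^ 3)⁻¹)) *
          derivAt f w.1 w.2 ∂halfMeasure = -(Real.pi / 2) * derivAt f v.1 v.2 := by
      rw [derivAt, i1.2, ← mul_assoc, show (-(Real.pi / 2) * -(2 / Real.pi) : ℂ) = 1 by field_simp,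
        one_mul]
    have j2 : ∫ w : ℝ × ℝ, ((w.1 : ℂ) *
        ((w.1 - w.2 * Complex.I + (v.1 + v.2 * Complex.I)) ^ 2)⁻¹) *
          derivAt f w.1 w.2 ∂halfMeasure =
        -(Real.pi / 2) * (extend f (v.1 + v.2 * Complex.I) - valueAtInfty f) := by
      rw [r2, sub_sub_cancel_left, neg_mul_neg, ← mul_assoc,
        show (Real.pi / 2 * (2 / Real.pi) : ℂ) = 1 by field_simp, one_mul]
    rw [j1, j2]
    simp only [besovIntegrand]
    rw [hf.derivAt_mul hg hv]
    simp only [smul_smul, ← sub_smul]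
    congr 1
    ring
  -- the inner integral in `v` is the calculus at `k_w g`, which vanishes at infinity
  have hright : ∫ w, ∫ v, doubleIntegrand R f g (v, w) ∂halfMeasure ∂halfMeasure =
      (-(Real.pi / 2) : ℂ) • (besovCalc R g * ∫ p, besovIntegrand R f p ∂halfMeasure) := by
    rw [← integral_const_mul_of_integrable hif, ← integral_smul]
    refine integral_congr_ae ?_
    filter_upwards [ae_halfMeasure, hk] with w hw hkw
    have ha : 0 < (w.1 - w.2 * Complex.I : ℂ).re := by simpa using hw
    have hb := isBesov_shiftedInv ha
    have hint : ∫ v, doubleIntegrand R f g (v, w) ∂halfMeasure =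
        ((w.1 : ℂ) * derivAt f w.1 w.2) • ∫ v, besovIntegrand R
          (shiftedInv (w.1 - w.2 * Complex.I) * shiftedInv (w.1 - w.2 * Complex.I) * g) v
          ∂halfMeasure := by
      rw [← integral_smul]
      refine integral_congr_ae ?_
      filter_upwards [ae_halfMeasure] with v hv
      simp only [doubleIntegrand, besovIntegrand]
      rw [derivAt_kernel_mul hg hv hw]
      simp only [smul_smul]
      congr 1
      ring
    rw [besovCalc, (isBesov_mul hb hb).valueAtInfty_mul hg, hb.valueAtInfty_mul hb,
      valueAtInfty_shiftedInv, zero_mul, zero_mul, zero_smul, zero_sub] at hkw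
    have hkw' := congrArg (fun y => (-(Real.pi / 2) : ℂ) • y) hkw
    simp only [smul_smul, ← neg_smul] at hkw'
    rw [show (-(Real.pi / 2) * -(2 / Real.pi) : ℂ) = 1 by field_simp, one_smul] at hkw'
    rw [hint, hkw']
    simp only [besovIntegrand, mul_smul_comm, smul_smul]
    congr 1
    ring
  rw [hleft, hright] at hswap
  have hne : (-(Real.pi / 2) : ℂ) ≠ 0 := by simp
  have hmain := smul_right_injective 𝔸 hne hswap
  simp only [sub_eq_iff_eq_add] at hmain
  rw [besovCalc, hf.valueAtInfty_mul hg, hmain]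
  conv_rhs => rw [besovCalc.eq_1 R f, mul_sub, mul_smul_comm, mul_one, mul_smul_comm,
    besovCalc.eq_1 R g, smul_sub]
  rw [← besovCalc.eq_1 R g]
  simp only [smul_add, smul_smul]
  rw [mul_comm (2 / Real.pi : ℂ) (valueAtInfty f)]
  abel

/-- Partial fractions for `(z + a)⁻² (z + b)⁻²`, matched with the resolvent identity. -/
theorem besovCalc_kernel_mul_kernel (hR : IsHalfPlaneResolvent R M) {a b : ℂ} (ha : 0 < a.re)
    (hb : 0 < b.re) (hab : a ≠ b) :
    besovCalc R (shiftedInv a * shiftedInv a * (shiftedInv b * shiftedInv b)) =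
      R b ^ 2 * R a ^ 2 := by
  have hne : b - a ≠ 0 := sub_ne_zero.2 hab.symm
  have Ba := isBesov_shiftedInv ha
  have Bb := isBesov_shiftedInv hb
  have h : shiftedInv a * shiftedInv a * (shiftedInv b * shiftedInv b) =
      ((b - a)⁻¹ ^ 2) • (shiftedInv a * shiftedInv a + (shiftedInv b * shiftedInv b +
        (-2 : ℂ) • (shiftedInv a * shiftedInv b))) := by
    funext z
    have h1 := add_ne_zero_of_re_pos z.2 ha
    have h2 := add_ne_zero_of_re_pos z.2 hb
    simp only [shiftedInv, Pi.mul_apply, Pi.smul_apply, Pi.add_apply, smul_eq_mul]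
    field_simp
    ring
  have B1 := isBesov_mul Ba Ba
  have B2 := isBesov_mul Bb Bb
  have B3 := (isBesov_mul Ba Bb).smul (-2)
  have hc := hR.commute ha hb
  have hprod : R a * R b = (b - a)⁻¹ • (R a - R b) := by
    rw [hR.sub_eq a b ha hb, smul_smul, inv_mul_cancel₀ hne, one_smul]
  have hsq : R b ^ 2 * R a ^ 2 = (R a * R b) * (R a * R b) := by
    rw [← ((hc.pow_pow 2 2).eq), ← hc.mul_pow, sq]
  rw [h, besovCalc_smul (isBesov_add B1 (isBesov_add B2 B3)),
    besovCalc_add hR B1 (isBesov_add B2 B3), besovCalc_add hR B2 B3,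
    besovCalc_smul (isBesov_mul Ba Bb), besovCalc_shiftedInv_mul_self hR ha,
    besovCalc_shiftedInv_mul_self hR hb, besovCalc_shiftedInv_mul hR ha hb hab, hsq, hprod,
    smul_mul_smul_comm, ← sq (b - a)⁻¹, ← hprod]
  congr 1
  rw [sub_mul, mul_sub, mul_sub, ← hc.eq, ← sq, ← sq, neg_smul, two_smul]
  abel

/-- Two applications of `besovCalc_mul_of_kernel`: the first, with a kernel as the factor `g`, rests
on partial fractions; its conclusion supplies the hypothesis of the second. -/
theorem besovCalc_mul (hR : IsHalfPlaneResolvent R M) (hf : IsBesov f) (hg : IsBesov g) :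
    besovCalc R (f * g) = besovCalc R f * besovCalc R g := by
  have hkernel : ∀ {h : halfPlane → ℂ}, IsBesov h → ∀ v : ℝ × ℝ, 0 < v.1 →
      besovCalc R (h * (shiftedInv (v.1 - v.2 * Complex.I) *
        shiftedInv (v.1 - v.2 * Complex.I))) =
        R (v.1 - v.2 * Complex.I) ^ 2 * besovCalc R h := by
    intro h hh v hv
    have hb : 0 < (v.1 - v.2 * Complex.I : ℂ).re := by simpa using hv
    rw [← besovCalc_shiftedInv_mul_self hR hb]
    refine besovCalc_mul_of_kernel hR hh
      (isBesov_mul (isBesov_shiftedInv hb) (isBesov_shiftedInv hb)) ?_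
    -- partial fractions fail only at `w = v`, a null set
    filter_upwards [ae_halfMeasure, ae_halfMeasure_ne v] with w hw hne
    rw [besovCalc_shiftedInv_mul_self hR hb]
    refine besovCalc_kernel_mul_kernel hR (by simpa using hw) hb fun heq => hne ?_
    have h1 := congrArg Complex.re heq
    have h2 := congrArg Complex.im heq
    simp at h1 h2
    exact Prod.ext h1 h2
  rw [mul_comm f g]
  refine besovCalc_mul_of_kernel hR hg hf ?_
  filter_upwards [ae_halfMeasure] with w hw
  rw [mul_comm _ f, hkernel hf w hw]
  exact ((commute_besovCalc hR hf (by simpa using hw)).pow_right 2).eq.symm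

end Multiplicativity

/-! ### Sectorial operators -/

section Sectorial

variable {X : Type*} [NormedAddCommGroup X] [NormedSpace ℂ X] {A : X →ₗ.[ℂ] X}

theorem closure_sector_subset_of_lt_pi_div_two {θ : ℝ} (hθ : θ < Real.pi / 2) :
    closure (sector θ) ⊆ {z : ℂ | 0 ≤ z.re} := by
  refine closure_minimal ?_ (isClosed_le continuous_const Complex.continuous_re)
  intro z hz
  by_cases h : θ = 0
  · rw [sector, if_pos h] at hz
    exact hz.1.le
  · rw [sector, if_neg h] at hz
    exact Complex.abs_arg_le_pi_div_two_iff.1 (hz.2.le.trans hθ.le)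

theorem sector_pi_div_two : sector (Real.pi - Real.pi / 2) = {z : ℂ | 0 < z.re} := by
  have h : Real.pi - Real.pi / 2 = Real.pi / 2 := by ring
  rw [h, sector, if_neg (by positivity)]
  ext z
  simp only [mem_ofPred_eq]
  rw [Complex.abs_arg_lt_pi_div_two_iff]
  constructor
  · rintro ⟨h1, h2 | h2⟩
    · exact h2
    · exact absurd h2 h1
  · intro h
    exact ⟨by rintro rfl; simp at h, Or.inl h⟩

theorem spectrumOf_subset_of_sectorial (hA : IsSectorialLTPiDivTwo A) :
    spectrumOf A ⊆ {z : ℂ | 0 ≤ z.re} := by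
  obtain ⟨θ, -, hθ, hs⟩ := hA
  exact hs.1.trans (closure_sector_subset_of_lt_pi_div_two hθ)

theorem isShiftInverse_shiftInv (hA : IsSectorialLTPiDivTwo A) {z : ℂ} (hz : 0 < z.re) :
    IsShiftInverse A z (shiftInv A z) := by
  have h : -z ∉ spectrumOf A := fun h => by
    have := spectrumOf_subset_of_sectorial hA h
    simp at this
    linarith
  rw [spectrumOf, mem_ofPred_eq, not_not, neg_neg] at h
  obtain ⟨R, hR⟩ := h
  rwa [hR.shiftInv_eq]

theorem IsShiftInverse.sub_eq {z w : ℂ} {R S : X →L[ℂ] X} (hR : IsShiftInverse A z R)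
    (hS : IsShiftInverse A w S) : R - S = (w - z) • (R * S) := by
  ext x
  obtain ⟨h, hx⟩ := hS.1 x
  have h1 := hR.2 ⟨S x, h⟩
  have h2 : x = (z • S x + A ⟨S x, h⟩) + (w - z) • S x := by
    rw [sub_smul]
    conv_lhs => rw [← hx]
    abel
  have h3 : R x = S x + (w - z) • R (S x) := by
    conv_lhs => rw [h2, map_add, map_smul]
    exact congrArg (· + (w - z) • R (S x)) h1
  simp [h3]

theorem isHalfPlaneResolvent_shiftInv (hA : IsSectorialLTPiDivTwo A) :
    IsHalfPlaneResolvent (shiftInv A) (sectConst A) where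
  sub_eq z w hz hw := (isShiftInverse_shiftInv hA hz).sub_eq (isShiftInverse_shiftInv hA hw)
  bound z hz := by
    obtain ⟨θ, -, hθ, hs⟩ := hA
    have hfin := hs.2 (Real.pi / 2) hθ (by linarith [Real.pi_pos])
    rw [← norm_smul, sectConst, ← ENNReal.ofReal_le_iff_le_toReal hfin.ne, ofReal_norm, sectorSup]
    refine le_iSup₂_of_le z ?_ le_rfl
    rwa [sector_pi_div_two]

/-- For `x` in the domain, `t (t + A)⁻¹ x → x` as `t → ∞`; hence the constant is at least `1`. -/
theorem one_le_sectConst [Nontrivial X] (hD : Dense (A.domain : Set X))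
    (hA : IsSectorialLTPiDivTwo A) : 1 ≤ sectConst A := by
  have hR := isHalfPlaneResolvent_shiftInv hA
  have hM := hR.nonneg
  obtain ⟨x, hx0, hxD⟩ : ∃ x : X, x ≠ 0 ∧ x ∈ A.domain := by
    by_contra! hcon
    have hsub : (A.domain : Set X) ⊆ {0} := fun x hx => by
      by_contra h
      exact hcon x h hx
    obtain ⟨y, hy⟩ := exists_ne (0 : X)
    have := closure_mono hsub (hD y)
    simp at this
    exact hy this
  have hxpos : 0 < ‖x‖ := norm_pos_iff.2 hx0
  have hbd : ∀ t : ℝ, 0 < t → ‖x‖ ≤ sectConst A * ‖x‖ + sectConst A * ‖A ⟨x, hxD⟩‖ / t := by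
    intro t ht
    have hre : 0 < (t : ℂ).re := by simpa using ht
    have hn : ‖(t : ℂ)‖ = t := by simp [abs_of_pos ht]
    have h1 := (isShiftInverse_shiftInv hA hre).2 ⟨x, hxD⟩
    rw [map_add, map_smul] at h1
    have h2 := hR.bound t hre
    have h3 := hR.norm_le hre
    rw [hn] at h2 h3
    calc ‖x‖ = ‖(t : ℂ) • shiftInv A t x + shiftInv A t (A ⟨x, hxD⟩)‖ := by rw [h1]
      _ ≤ t * (‖shiftInv A t‖ * ‖x‖) + ‖shiftInv A t‖ * ‖A ⟨x, hxD⟩‖ := by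
          refine (norm_add_le _ _).trans (add_le_add ?_ (ContinuousLinearMap.le_opNorm _ _))
          rw [norm_smul, hn]
          gcongr
          exact ContinuousLinearMap.le_opNorm _ _
      _ ≤ sectConst A * ‖x‖ + sectConst A / t * ‖A ⟨x, hxD⟩‖ := by
          rw [← mul_assoc]
          gcongr
      _ = _ := by ring
  have hlim : Tendsto (fun t : ℝ => sectConst A * ‖x‖ + sectConst A * ‖A ⟨x, hxD⟩‖ / t) atTop
      (𝓝 (sectConst A * ‖x‖ + 0)) :=
    tendsto_const_nhds.add (tendsto_const_nhds.div_atTop tendsto_id)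
  have := ge_of_tendsto hlim ((eventually_gt_atTop 0).mono hbd)
  rw [add_zero] at this
  exact le_of_mul_le_mul_right (by simpa using this) hxpos

theorem enorm_eq_zero_of_subsingleton [Subsingleton X] (T : X →L[ℂ] X) : ‖T‖ₑ = 0 := by
  have h : T = 0 := by
    ext x
    exact Subsingleton.elim _ _
  rw [h, ← ofReal_norm, norm_zero, ENNReal.ofReal_zero]

/-- For `X = {0}` both sides vanish, since then the constant of `A` is `0`. -/
theorem lintegral_enorm_shiftInv_sq_le (hD : Dense (A.domain : Set X))
    (hA : IsSectorialLTPiDivTwo A) {α : ℝ} (hα : 0 < α) :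
    ∫⁻ β : ℝ, ‖shiftInv A (α + β * Complex.I) ^ 2‖ₑ ≤
      ENNReal.ofReal (10 * sectConst A * (Real.log (sectConst A) + 1) / α) := by
  rcases subsingleton_or_nontrivial X with h | h
  · simp [enorm_eq_zero_of_subsingleton]
  · exact (isHalfPlaneResolvent_shiftInv hA).lintegral_norm_sq_le (one_le_sectConst hD hA) hα

theorem enorm_resolventSq_le (x : X) (x' : StrongDual ℂ X) (α β : ℝ) :
    ‖resolventSq A x x' α β‖ₑ ≤ ‖shiftInv A (α + β * Complex.I) ^ 2‖ₑ * (‖x‖ₑ * ‖x'‖ₑ) := by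
  refine (x'.le_opENorm _).trans ((mul_le_mul' le_rfl
    (ContinuousLinearMap.le_opENorm _ _)).trans_eq ?_)
  ring

theorem lintegral_resolventSq_le (hD : Dense (A.domain : Set X)) (hA : IsSectorialLTPiDivTwo A)
    (x : X) (x' : StrongDual ℂ X) {α : ℝ} (hα : 0 < α) :
    ∫⁻ β : ℝ, ‖resolventSq A x x' α β‖ₑ ≤
      ENNReal.ofReal (10 * sectConst A * (Real.log (sectConst A) + 1)) / ENNReal.ofReal α *
        ‖x‖ₑ * ‖x'‖ₑ := by
  refine (lintegral_mono fun β => enorm_resolventSq_le x x' α β).trans ?_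
  rw [lintegral_mul_const' _ _ (ENNReal.mul_ne_top enorm_ne_top enorm_ne_top), mul_assoc,
    ← ENNReal.ofReal_div_of_pos hα]
  exact mul_le_mul' (lintegral_enorm_shiftInv_sq_le hD hA hα) le_rfl

theorem satisfiesGSF_of_sectorial (hD : Dense (A.domain : Set X))
    (hA : IsSectorialLTPiDivTwo A) : SatisfiesGSF A := by
  refine ⟨spectrumOf_subset_of_sectorial hA, fun x x' => ?_⟩
  refine lt_of_le_of_lt (b := ENNReal.ofReal (10 * sectConst A * (Real.log (sectConst A) + 1)) *
    ‖x‖ₑ * ‖x'‖ₑ) (iSup₂_le fun α hα => ?_)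
    (ENNReal.mul_lt_top (ENNReal.mul_lt_top ENNReal.ofReal_lt_top enorm_lt_top) enorm_lt_top)
  have hα' : 0 < α := hα
  refine (mul_le_mul' le_rfl (lintegral_resolventSq_le hD hA x x' hα')).trans (le_of_eq ?_)
  rw [← mul_assoc, ← mul_assoc, ENNReal.mul_div_cancel (by simpa using hα') ENNReal.ofReal_ne_top]

theorem gsfConst_le (hD : Dense (A.domain : Set X)) (hA : IsSectorialLTPiDivTwo A) :
    gsfConst A ≤ ENNReal.ofReal (10 * sectConst A * (Real.log (sectConst A) + 1)) :=
  sInf_le fun _ hα x x' => lintegral_resolventSq_le hD hA x x' hα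

theorem integrable_opIntegrand (hA : IsSectorialLTPiDivTwo A) (f : besov) {α : ℝ} (hα : 0 < α) :
    Integrable (fun β : ℝ => opIntegrand A f α β) :=
  integrable_line (isHalfPlaneResolvent_shiftInv hA) f.2 hα

theorem integrableOn_opIntegrand (hA : IsSectorialLTPiDivTwo A) (f : besov) :
    IntegrableOn (fun p : ℝ × ℝ => (p.1 : ℂ) • opIntegrand A f p.1 p.2) (Ioi 0 ×ˢ univ) :=
  integrable_besovIntegrand (isHalfPlaneResolvent_shiftInv hA) f.2

variable [CompleteSpace X]

/-- The calculus of a sectorial operator as an algebra homomorphism. -/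
noncomputable def besovHom (hA : IsSectorialLTPiDivTwo A) : besov →ₐ[ℂ] (X →L[ℂ] X) where
  toFun f := besovCalc (shiftInv A) f
  map_one' := (besovCalc_const 1).trans (one_smul _ _)
  map_mul' f g := besovCalc_mul (isHalfPlaneResolvent_shiftInv hA) f.2 g.2
  map_zero' := (besovCalc_const 0).trans (zero_smul _ _)
  map_add' f g := besovCalc_add (isHalfPlaneResolvent_shiftInv hA) f.2 g.2
  commutes' c := (besovCalc_const c).trans (Algebra.algebraMap_eq_smul_one c).symm

theorem norm_besovHom_le (hD : Dense (A.domain : Set X)) (hA : IsSectorialLTPiDivTwo A)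
    (f : besov) : ‖besovHom hA f‖ ≤
      10 * sectConst A * (Real.log (sectConst A) + 1) * besovNorm f := by
  rcases subsingleton_or_nontrivial X with h | h
  · have hM : sectConst A = 0 := by
      simp [sectConst, sectorSup, enorm_eq_zero_of_subsingleton]
    rw [hM, ← toReal_enorm, enorm_eq_zero_of_subsingleton]
    simp
  have hM := one_le_sectConst hD hA
  have hlog := Real.log_nonneg hM
  set K := 10 * sectConst A * (Real.log (sectConst A) + 1) with hK
  have hK1 : 1 ≤ K := by nlinarith [mul_nonneg (zero_le_one.trans hM) hlog]
  have hf : IsBesov (f : halfPlane → ℂ) := f.2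
  have h1 : ‖∫ p, besovIntegrand (shiftInv A) f p ∂halfMeasure‖ ≤ K * (besovSeminorm f).toReal := by
    have h := (enorm_integral_le_lintegral_enorm (besovIntegrand (shiftInv A) f)).trans
      (lintegral_enorm_besovIntegrand_le hf fun α hα => lintegral_enorm_shiftInv_sq_le hD hA hα)
    rw [← ENNReal.toReal_ofReal (zero_le_one.trans hK1), ← ENNReal.toReal_mul,
      ← ENNReal.ofReal_le_iff_le_toReal (ENNReal.mul_ne_top ENNReal.ofReal_ne_top hf.2.ne),
      ofReal_norm]
    exact h
  have h2 : ‖(2 / Real.pi : ℂ)‖ ≤ 1 := by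
    rw [norm_div, Complex.norm_real, Real.norm_of_nonneg Real.pi_pos.le,
      div_le_one Real.pi_pos]
    simpa using Real.two_le_pi
  have h3 := hf.norm_valueAtInfty_le
  have h4 : (0 : ℝ) ≤ (⨆ z : halfPlane, ‖(f : halfPlane → ℂ) z‖ₑ).toReal :=
    ENNReal.toReal_nonneg
  calc ‖besovHom hA f‖ ≤ ‖valueAtInfty f • (1 : X →L[ℂ] X)‖ +
        ‖(2 / Real.pi : ℂ) • ∫ p, besovIntegrand (shiftInv A) f p ∂halfMeasure‖ := norm_sub_le _ _
    _ ≤ (⨆ z : halfPlane, ‖(f : halfPlane → ℂ) z‖ₑ).toReal + K * (besovSeminorm f).toReal := by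
        rw [norm_smul, norm_smul, norm_one, mul_one]
        refine add_le_add h3 ?_
        calc _ ≤ 1 * (K * (besovSeminorm f).toReal) := by gcongr
          _ = _ := one_mul _
    _ ≤ K * besovNorm f := by
        rw [besovNorm, mul_add]
        gcongr
        exact le_mul_of_one_le_left h4 hK1

theorem besovHom_eq (hA : IsSectorialLTPiDivTwo A) (f : besov) :
    besovHom hA f = valueAtInfty f • ContinuousLinearMap.id ℂ X - (2 / Real.pi : ℂ) •
      ∫ α in Ioi (0 : ℝ), (α : ℂ) • ∫ β : ℝ, opIntegrand A f α β := by
  have hi := integrable_besovIntegrand (isHalfPlaneResolvent_shiftInv hA) f.2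
  have h : ∫ p, besovIntegrand (shiftInv A) f p ∂halfMeasure =
      ∫ α in Ioi (0 : ℝ), (α : ℂ) • ∫ β : ℝ, opIntegrand A f α β := by
    rw [halfMeasure_eq] at hi ⊢
    rw [integral_prod _ hi]
    simp_rw [← integral_smul]
    rfl
  rw [← h]
  rfl

theorem isWeakValue_besovHom (hA : IsSectorialLTPiDivTwo A) (f : besov) :
    IsWeakValue A f (besovHom hA f) := by
  intro x x'
  set ℓ : (X →L[ℂ] X) →L[ℂ] ℂ := x'.comp (ContinuousLinearMap.apply ℂ X x) with hℓ
  have hop : ∀ α β : ℝ, resolventSq A x x' α (-β) * derivAt f α β = ℓ (opIntegrand A f α β) := by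
    intro α β
    have h1 : (α + ((-β : ℝ) : ℂ) * Complex.I : ℂ) = α - β * Complex.I := by push_cast; ring
    rw [hℓ, opIntegrand, resolventSq, h1]
    simp [mul_comm]
  have hi := integrableOn_opIntegrand hA f
  constructor
  · refine (ℓ.integrable_comp hi).congr (ae_of_all _ fun p => ?_)
    simp only [hop, map_smul, smul_eq_mul]
  · have hi' : Integrable (fun p : ℝ × ℝ => (p.1 : ℂ) • opIntegrand A f p.1 p.2)
        ((volume.restrict (Ioi (0 : ℝ))).prod volume) := by
      rw [← halfMeasure_eq]
      exact hi
    have hi1 : IntegrableOn (fun α : ℝ => (α : ℂ) • ∫ β : ℝ, opIntegrand A f α β) (Ioi 0) := by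
      have := hi'.integral_prod_left
      simp_rw [integral_smul] at this
      exact this
    have h2 : ℓ (∫ α in Ioi (0 : ℝ), (α : ℂ) • ∫ β : ℝ, opIntegrand A f α β) =
        ∫ α in Ioi (0 : ℝ), (α : ℂ) * ∫ β : ℝ, resolventSq A x x' α (-β) * derivAt f α β := by
      rw [← ℓ.integral_comp_comm hi1]
      refine setIntegral_congr_fun measurableSet_Ioi fun α hα => ?_
      simp only [hop, map_smul, smul_eq_mul]
      rw [ℓ.integral_comp_comm (integrable_opIntegrand hA f hα)]
    have h3 : x' (besovHom hA f x) = ℓ (besovHom hA f) := rfl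
    rw [h3, besovHom_eq, map_sub, map_smul, map_smul, h2]
    rfl

theorem isBesovCalculus_besovHom (hD : Dense (A.domain : Set X))
    (hA : IsSectorialLTPiDivTwo A) : IsBesovCalculus A (besovHom hA) :=
  ⟨⟨_, norm_besovHom_le hD hA⟩,
    fun z => besovCalc_shiftedInv (isHalfPlaneResolvent_shiftInv hA) z.2⟩

end Sectorial
end BesovCalculus

theorem theorem4p1 :
    ∃ C : ℝ, 0 < C ∧
      ∀ (X : Type*) [NormedAddCommGroup X] [NormedSpace ℂ X] [CompleteSpace X]
        (A : X →ₗ.[ℂ] X), A.IsClosed → Dense (A.domain : Set X) → IsSectorialLTPiDivTwo A →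
        SatisfiesGSF A ∧
        gsfConst A ≤ ENNReal.ofReal (C * sectConst A * (Real.log (sectConst A) + 1)) ∧
        ∃ Φ : besov →ₐ[ℂ] (X →L[ℂ] X), IsBesovCalculus A Φ ∧
          ∀ f : besov,
            IsWeakValue A f (Φ f) ∧
            ‖Φ f‖ ≤ C * sectConst A * (Real.log (sectConst A) + 1) * besovNorm f ∧
            (∀ α : ℝ, 0 < α → Integrable (fun β : ℝ => opIntegrand A f α β)) ∧
            IntegrableOn (fun p : ℝ × ℝ => (p.1 : ℂ) • opIntegrand A f p.1 p.2)
              (Ioi 0 ×ˢ univ) ∧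
            Φ f = valueAtInfty f • ContinuousLinearMap.id ℂ X -
              (2 / Real.pi : ℂ) •
                ∫ α in Ioi (0 : ℝ), (α : ℂ) • ∫ β : ℝ, opIntegrand A f α β :=
  ⟨10, by norm_num, fun _ _ _ _ _ _ hD hA =>
    ⟨satisfiesGSF_of_sectorial hD hA, gsfConst_le hD hA, besovHom hA,
      isBesovCalculus_besovHom hD hA, fun f =>
        ⟨isWeakValue_besovHom hA f, norm_besovHom_le hD hA f,
          fun _ hα => integrable_opIntegrand hA f hα, integrableOn_opIntegrand hA f,
          besovHom_eq hA f⟩⟩⟩
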